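/- Let $n\in\mathbb N$, let $\mathbb N_\bot$ be the flat domain of natural numbers, and let $\iota\to\iota$ be interpreted as the set of all monotone functions $f:\mathbb N_\bot\to\mathbb N_\bot$, ordered pointwise. Functions $(\mathbb N_\bot\to\mathbb N_\bot)^n\to\mathbb N_\bot$ always take $n$-tuples $\vec f=(f_1,\dots,f_n)$ of monotone functions as arguments, and they too are ordered pointwise (order $\sqsubseteq$). The *sequential procedures* in the variables $x_1,\dots,x_n$ of type $\iota\to\iota$ form the largest class (coinductive definition) of possibly infinite terms $P$ such that $P$ is a constant $c\in\mathbb N_\bot$ or $P=\mathrm{case}\ x_i(Q)\ \mathrm{of}\ \{a\Rightarrow P_a\}_{a\in\mathbb N}$ with $1\le i\le n$ and sequential procedures $Q$ and $P_a$. A procedure $P$ defines the function $[\![P]\!]:(\mathbb N_\bot\to\mathbb N_\bot)^n\to\mathbb N_\bot$ given inductively by: $[\![c]\!](\vec f)=c$; and for $P=\mathrm{case}\ x_i(Q)\ \mathrm{of}\ \{a\Rightarrow P_a\}$, $[\![P]\!](\vec f)=b\in\mathbb N$ if $f_i([\![Q]\!](\vec f))=a$ and $[\![P_a]\!](\vec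 f)=b$ for some $a\in\mathbb N$; $[\![P]\!](\vec f)=\bot$ if no value is given by these clauses. A *sequential functional* of type $(\iota\to\iota)^n\to\iota$ is a function of the form $[\![P]\!]$. For $S\subseteq\{1,\dots,n\}$ and a sequential functional $F$, let $F_S$ be the function with $F_S(\vec f)=a\in\mathbb N$ if and only if there is $\vec g\sqsubseteq\vec f$ such that $g_i(\bot)=\bot$ for all $i\in S$ and $F(\vec g)=a$. **Theorem.** 1. If $F_0\sqsubseteq F_1\sqsubseteq\cdots$ is an increasing sequence of sequential functionals of type $(\iota\to\iota)^n\to\iota$, then its pointwise least upper bound $\bigsqcup_k F_k$ exists and is a sequential functional. 2. The sequential functionals of type $(\iota\to\iota)^n\to\iota$, ordered pointwise, form a dcpo: every non-empty directed set of them has a least upper bound among them, and this is the pointwise least upper bound. 3. (Key Lemma) If $F_0\sqsubseteq F_1\sqsubseteq\cdots$ is an increasing sequence of sequential functionals of type $(\iota\to\iota)^n\to\iota$ and $S\subseteq\{1,\dots,n\}$, then the pointwise least upper bound $\bigsqcup_k (F_k)_S$ exists and is a sequential functional. -/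

import Mathlib

namespace SeqFun

/-- The flat domain `ℕ_⊥`. The order of `Part ℕ` is the flat one: `x ≤ y` iff `x` is undefined
or `x = y`; `⊥ = Part.none` is the undefined element, and `a ∈ x` says that `x` is defined with
value `a`. -/
abbrev NBot : Type := Part ℕ

/-- The interpretation of `ι → ι`: the monotone functions `ℕ_⊥ → ℕ_⊥`, ordered pointwise. -/
abbrev Fn : Type := NBot →o NBot

/-- The functions `(ℕ_⊥ → ℕ_⊥)^n → ℕ_⊥`, ordered pointwise. -/
abbrev Functional (n : ℕ) : Type := (Fin n → Fn) → NBot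

/-- The signature of sequential procedures: a node is a constant in `ℕ_⊥`, without children, or
a case distinction on `x_i`, whose children are the argument `Q` (at `none`) and the
continuations `P_a` (at `some a`). -/
def procSig (n : ℕ) : PFunctor.{0, 0} where
  A := NBot ⊕ Fin n
  B := fun s => Sum.elim (fun _ => Empty) (fun _ => Option ℕ) s

/-- The sequential procedures in the variables `x_1, …, x_n` of type `ι → ι`: the coinductive
type of all, possibly infinite and possibly non-well-founded, trees over the signature. -/
abbrev Proc (n : ℕ) : Type := (procSig n).M

variable {n : ℕ}

/-- The constant procedure `c`. -/
def Proc.const (c : NBot) : Proc n :=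
  PFunctor.M.mk (F := procSig n) ⟨Sum.inl c, fun e => Empty.elim e⟩

/-- The procedure `case x_i(Q) of {a ⇒ P_a}`. -/
def Proc.caseOf (i : Fin n) (Q : Proc n) (P : ℕ → Proc n) : Proc n :=
  PFunctor.M.mk (F := procSig n)
    ⟨Sum.inr i, fun o => Option.elim (show Option ℕ from o) Q P⟩

/-- `Eval f P b` says that evaluating `P` at `f` gives the value `b ∈ ℕ`. In the second clause
the premise `∀ m ∈ c, Eval f Q m` says that `c` is `⊥` or the value of `Q`; since `f i` is
monotone, allowing `c = ⊥` here gives nothing new when `Q` has a value, and so the clause is the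
usual one, with the value of `Q` in `ℕ_⊥` as the argument of `f i` (see `denote_caseOf`). -/
inductive Eval (f : Fin n → Fn) : Proc n → ℕ → Prop
  | const (c : NBot) (a : ℕ) (h : a ∈ c) : Eval f (Proc.const c) a
  | caseOf (i : Fin n) (Q : Proc n) (P : ℕ → Proc n) (c : NBot) (a b : ℕ)
      (hQ : ∀ m ∈ c, Eval f Q m) (ha : a ∈ f i c) (hP : Eval f (P a) b) :
      Eval f (Proc.caseOf i Q P) b

/-- The element of `ℕ_⊥` whose value is the number with the property `R`; it is `⊥` if there is
no such number. It is used for properties that at most one number has. -/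
noncomputable def valueOf (R : ℕ → Prop) : NBot := ⟨∃ a, R a, fun h => h.choose⟩

/-- The function `⟦P⟧ : (ℕ_⊥ → ℕ_⊥)^n → ℕ_⊥` defined by a procedure. -/
noncomputable def denote (P : Proc n) : Functional n := fun f => valueOf (Eval f P)

/-- The sequential functionals of type `(ι → ι)^n → ι`. -/
def IsSequential (F : Functional n) : Prop := ∃ P : Proc n, denote P = F

/-- The set of sequential functionals, with the pointwise order. -/
abbrev SeqFunctional (n : ℕ) : Type := {F : Functional n // IsSequential F}

/-- The `S`-strictification `F_S`: its value at `f` is `a` if `F` has the value `a` at some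
`g ⊑ f` with `g_i` strict for all `i ∈ S`. -/
noncomputable def strictify (S : Set (Fin n)) (F : Functional n) : Functional n := fun f =>
  valueOf fun a => ∃ g : Fin n → Fn, g ≤ f ∧ (∀ i ∈ S, g i ⊥ = ⊥) ∧ a ∈ F g

/-! The values above are unique, so that the definitions do not depend on choices. -/

theorem mem_valueOf {R : ℕ → Prop} (hR : ∀ a b, R a → R b → a = b) (a : ℕ) :
    a ∈ valueOf R ↔ R a := by
  constructor
  · rintro ⟨h, rfl⟩
    exact h.choose_spec
  · intro h
    exact ⟨⟨a, h⟩, hR _ _ (Exists.choose_spec (p := R) ⟨a, h⟩) h⟩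

theorem Proc.const_inj {c d : NBot} (h : (Proc.const c : Proc n) = Proc.const d) : c = d := by
  have h' := PFunctor.M.mk_inj h
  exact Sum.inl.inj (congrArg Sigma.fst h')

theorem Proc.const_ne_caseOf {c : NBot} {i : Fin n} {Q : Proc n} {P : ℕ → Proc n} :
    Proc.const c ≠ Proc.caseOf i Q P := by
  intro h
  have h' := PFunctor.M.mk_inj h
  exact Sum.inl_ne_inr (congrArg Sigma.fst h')

theorem Proc.caseOf_inj {i j : Fin n} {Q R : Proc n} {P P' : ℕ → Proc n}
    (h : Proc.caseOf i Q P = Proc.caseOf j R P') : i = j ∧ Q = R ∧ P = P' := by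
  have h' := PFunctor.M.mk_inj h
  have hij : i = j := Sum.inr.inj (congrArg Sigma.fst h')
  subst hij
  have h2 := eq_of_heq (Sigma.mk.inj h').2
  exact ⟨rfl, congrFun h2 (none : Option ℕ), funext fun a => congrFun h2 (some a : Option ℕ)⟩

/-- Every procedure is a constant or a case distinction. -/
theorem Proc.cases (P : Proc n) :
    (∃ c, P = Proc.const c) ∨ ∃ i Q P', P = Proc.caseOf i Q P' := by
  rw [← PFunctor.M.mk_dest P]
  rcases PFunctor.M.dest P with ⟨c | i, k⟩
  · refine Or.inl ⟨c, congrArg PFunctor.M.mk ?_⟩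
    exact congrArg (Sigma.mk _) (funext fun e => Empty.elim e)
  · refine Or.inr ⟨i, k (none : Option ℕ), fun a => k (some a : Option ℕ),
      congrArg PFunctor.M.mk ?_⟩
    refine congrArg (Sigma.mk _) (funext fun o => ?_)
    cases (show Option ℕ from o) <;> rfl

theorem mem_of_le_fn (g : Fn) {c d : NBot} (h : c ≤ d) {a : ℕ} (ha : a ∈ g c) : a ∈ g d :=
  g.monotone h a ha

theorem Eval.unique {f : Fin n → Fn} {P : Proc n} {a b : ℕ} (h : Eval f P a) (h' : Eval f P b) :
    a = b := by
  induction h generalizing b with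
  | const c a h =>
    generalize hP : (Proc.const c : Proc n) = P at h'
    cases h' with
    | const d _ hd => exact Part.mem_unique h (Proc.const_inj hP ▸ hd)
    | caseOf => exact absurd hP Proc.const_ne_caseOf
  | caseOf i Q P c a b₁ hQ ha hP ihQ ihP =>
    generalize hE : Proc.caseOf i Q P = E at h'
    cases h' with
    | const d _ hd => exact absurd hE.symm Proc.const_ne_caseOf
    | caseOf j R P' d a' _ hR ha' hP' =>
      obtain ⟨rfl, rfl, rfl⟩ := Proc.caseOf_inj hE
      have key : a = a' := by
        by_cases hc : c = ⊥
        · exact Part.mem_unique (mem_of_le_fn (f i) (hc ▸ bot_le : c ≤ d) ha) ha'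
        · have hdc : d ≤ c := by
            intro m hm
            obtain ⟨m', hm'⟩ := Part.ne_none_iff.mp hc
            have hm'c : m' ∈ c := hm' ▸ Part.mem_some m'
            exact ihQ m' hm'c (hR m hm) ▸ hm'c
          exact Part.mem_unique ha (mem_of_le_fn (f i) hdc ha')
      subst key
      exact ihP hP'

theorem mem_denote {P : Proc n} {f : Fin n → Fn} {b : ℕ} : b ∈ denote P f ↔ Eval f P b :=
  mem_valueOf (fun _ _ h h' => Eval.unique h h') b

theorem denote_const (c : NBot) (f : Fin n → Fn) : denote (Proc.const c) f = c := by
  ext a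
  rw [mem_denote]
  constructor
  · intro h
    generalize hP : (Proc.const c : Proc n) = P at h
    cases h with
    | const d _ hd => exact Proc.const_inj hP ▸ hd
    | caseOf => exact absurd hP Proc.const_ne_caseOf
  · exact Eval.const c a

/-- The value of `case x_i(Q) of {a ⇒ P_a}` at `f` is `b` iff `f_i(⟦Q⟧(f))` is some `a ∈ ℕ` and
`⟦P_a⟧(f) = b`. -/
theorem denote_caseOf (i : Fin n) (Q : Proc n) (P : ℕ → Proc n) (f : Fin n → Fn) :
    denote (Proc.caseOf i Q P) f = (f i (denote Q f)).bind fun a => denote (P a) f := by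
  ext b
  rw [mem_denote, Part.mem_bind_iff]
  constructor
  · intro h
    generalize hE : Proc.caseOf i Q P = E at h
    cases h with
    | const d _ hd => exact absurd hE.symm Proc.const_ne_caseOf
    | caseOf j R P' d a _ hR ha hP =>
      obtain ⟨rfl, rfl, rfl⟩ := Proc.caseOf_inj hE
      exact ⟨a, mem_of_le_fn (f i) (fun m hm => mem_denote.mpr (hR m hm)) ha, mem_denote.mpr hP⟩
  · rintro ⟨a, ha, hb⟩
    exact Eval.caseOf i Q P (denote Q f) a b (fun m hm => mem_denote.mp hm) ha (mem_denote.mp hb)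

theorem denote_mono (P : Proc n) : Monotone (denote P) := by
  intro f g hfg b hb
  rw [mem_denote] at hb ⊢
  induction hb with
  | const c a h => exact Eval.const c a h
  | caseOf i Q P c a b _ ha _ ihQ ihP => exact Eval.caseOf i Q P c a b ihQ (hfg i c a ha) ihP

theorem IsSequential.monotone {F : Functional n} (hF : IsSequential F) : Monotone F := by
  obtain ⟨P, rfl⟩ := hF
  exact denote_mono P

theorem mem_strictify {S : Set (Fin n)} {F : Functional n} (hF : Monotone F) {f : Fin n → Fn}
    {a : ℕ} : a ∈ strictify S F f ↔
      ∃ g : Fin n → Fn, g ≤ f ∧ (∀ i ∈ S, g i ⊥ = ⊥) ∧ a ∈ F g := by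
  refine mem_valueOf ?_ a
  rintro a b ⟨g, hg, -, ha⟩ ⟨g', hg', -, hb⟩
  exact Part.mem_unique (hF hg a ha) (hF hg' b hb)

end SeqFun

/-! The procedures of a directed family need not resemble each other, so the procedure for the
supremum is built from a limit: all of them are cut off at all depths, and an ultrafilter on the
indices decides what the limit procedure does next. `Lim` admits only values that are reached at one
finite restriction of the arguments; for the ultrafilter in `exists_isSequential_sup` this gives
exactly the pointwise supremum.

`exists_proc_lim` constructs the procedure by induction on the number of variables outside `S`,
where those in `S` are made strict. The argument of a strict variable can be evaluated first, so
`normalize` turns its queries into queries at numbers. On a finitely supported argument only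
finitely many kinds of first query remain, and the ultrafilter selects one (`exists_head`). If it is
a query to `x_j` with `j ∉ S`, the arguments vary over the family; the induction hypothesis supplies
their limit as if `x_j` were strict. Otherwise `x_j` is constant and its argument is irrelevant.

After an answer `v`, `x_j` is provisionally treated as constant and later queries to it are skipped.
This guess is tested by asking `x_j` where, if it is strict, it would be the first variable to
deviate (`deviation`). An answer other than `v` proves `x_j` strict, and the induction hypothesis
completes the computation. If all tests return the known answers, skipping was correct
(`den_follow`). Termination (`rank`) is needed on finitely supported arguments only, since
monotonicity carries the value to all others. -/

namespace SeqFun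
open Classical Filter

/-! ### Finite and strict parts of monotone functions -/

/-- The restriction of `g` to the finite set `D` of arguments; constants are not changed. -/
def Fn.restrict (g : Fn) (D : Finset ℕ) : Fn where
  toFun c := ⟨(g c).Dom ∧ ((g ⊥).Dom ∨ ∃ m ∈ D, m ∈ c), fun h => (g c).get h.1⟩
  monotone' := by
    rintro c d hcd a ⟨⟨h1, h2⟩, rfl⟩
    have h3 := mem_of_le_fn g hcd (Part.get_mem h1)
    obtain ⟨h4, h5⟩ := h3
    exact ⟨⟨h4, h2.imp_right fun ⟨m, hm, hc⟩ => ⟨m, hm, hcd m hc⟩⟩, h5⟩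

theorem Fn.mem_restrict {g : Fn} {D : Finset ℕ} {c : NBot} {b : ℕ} :
    b ∈ g.restrict D c ↔ b ∈ g c ∧ ((g ⊥).Dom ∨ ∃ m ∈ D, m ∈ c) :=
  ⟨fun ⟨h, e⟩ => ⟨⟨h.1, e⟩, h.2⟩, fun ⟨⟨h, e⟩, h'⟩ => ⟨⟨h, h'⟩, e⟩⟩

/-- The largest strict function below `g`. -/
def Fn.strictPart (g : Fn) : Fn where
  toFun c := ⟨(g c).Dom ∧ c.Dom, fun h => (g c).get h.1⟩
  monotone' := by
    rintro c d hcd a ⟨⟨h1, h2⟩, rfl⟩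
    obtain ⟨h4, h5⟩ := mem_of_le_fn g hcd (Part.get_mem h1)
    exact ⟨⟨h4, (hcd _ (Part.get_mem h2)).1⟩, h5⟩

theorem Fn.mem_strictPart {g : Fn} {c : NBot} {b : ℕ} :
    b ∈ g.strictPart c ↔ b ∈ g c ∧ c.Dom :=
  ⟨fun ⟨h, e⟩ => ⟨⟨h.1, e⟩, h.2⟩, fun ⟨⟨h, e⟩, h'⟩ => ⟨⟨h, h'⟩, e⟩⟩

theorem not_dom_bot : ¬ (⊥ : NBot).Dom := fun h => h

theorem not_mem_bot {a : ℕ} : a ∉ (⊥ : NBot) := fun h => h.1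

theorem Fn.strictPart_bot (g : Fn) : ¬ (g.strictPart ⊥).Dom := fun h => h.2

theorem Fn.strictPart_some (g : Fn) (m : ℕ) : g.strictPart (Part.some m) = g (Part.some m) := by
  ext b
  simp [Fn.mem_strictPart]

theorem Fn.strictPart_eq {g : Fn} (h : ¬ (g ⊥).Dom) : g.strictPart = g := by
  ext c b
  rw [Fn.mem_strictPart]
  refine ⟨And.left, fun hb => ⟨hb, ?_⟩⟩
  by_contra hc
  rw [Part.eq_none_iff'.mpr hc] at hb
  exact h hb.1

/-- A function with a value at `⊥` is constant. -/
theorem Fn.mem_of_mem_bot {g : Fn} {a : ℕ} (h : a ∈ g ⊥) (c : NBot) : a ∈ g c :=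
  mem_of_le_fn g bot_le h

theorem Fn.mem_bot_of_mem {g : Fn} (h : (g ⊥).Dom) {c : NBot} {a : ℕ} (ha : a ∈ g c) :
    a ∈ g ⊥ := by
  have h1 := Part.get_mem h
  rwa [← Part.mem_unique (Fn.mem_of_mem_bot h1 c) ha]

/-- A strict function has values at proper numbers only. -/
theorem Fn.exists_mem_arg {g : Fn} (h : ¬ (g ⊥).Dom) {c : NBot} {a : ℕ} (ha : a ∈ g c) :
    ∃ m, m ∈ c := by
  by_contra hc
  have : c = ⊥ := Part.eq_none_iff.mpr fun m hm => hc ⟨m, hm⟩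
  exact h (this ▸ ha).1

theorem Fn.restrict_bot_dom {g : Fn} {D : Finset ℕ} : (g.restrict D ⊥).Dom ↔ (g ⊥).Dom :=
  ⟨fun h => h.1, fun h => ⟨h, Or.inl h⟩⟩

theorem Fn.mem_restrict_bot {g : Fn} {D : Finset ℕ} {a : ℕ} :
    a ∈ g.restrict D ⊥ ↔ a ∈ g ⊥ :=
  Fn.mem_restrict.trans ⟨And.left, fun h => ⟨h, Or.inl h.1⟩⟩

theorem eq_some_of_mem {c : NBot} {m : ℕ} (h : m ∈ c) : c = Part.some m := Part.eq_some_iff.mpr h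

theorem Fn.mem_restrict_of_mem {g : Fn} {D : Finset ℕ} {c : NBot} {a m : ℕ} (h : a ∈ g c)
    (hm : m ∈ c) (hD : m ∈ D) : a ∈ g.restrict D c :=
  Fn.mem_restrict.mpr ⟨h, Or.inr ⟨m, hD, hm⟩⟩

variable {n : ℕ}

/-- The restriction of all components to the finite set `D` of arguments. -/
def restrictAll (f : Fin n → Fn) (D : Finset ℕ) : Fin n → Fn := fun i => (f i).restrict D

theorem restrictAll_le (f : Fin n → Fn) (D : Finset ℕ) : restrictAll f D ≤ f :=
  fun _ _ _ h => (Fn.mem_restrict.mp h).1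

theorem restrictAll_mono {f : Fin n → Fn} {D D' : Finset ℕ} (h : D ⊆ D') :
    restrictAll f D ≤ restrictAll f D' := fun _ _ _ ha => by
  obtain ⟨h1, h2⟩ := Fn.mem_restrict.mp ha
  exact Fn.mem_restrict.mpr ⟨h1, h2.imp_right fun ⟨m, hm, hc⟩ => ⟨m, h hm, hc⟩⟩

theorem restrictAll_restrictAll (f : Fin n → Fn) (D : Finset ℕ) :
    restrictAll (restrictAll f D) D = restrictAll f D := by
  funext i
  ext c b
  simp only [restrictAll, Fn.mem_restrict, Fn.restrict_bot_dom]
  tauto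

/-- The components in `S` are replaced by their strict parts. -/
noncomputable def strictOn (S : Set (Fin n)) (f : Fin n → Fn) : Fin n → Fn :=
  fun i => if i ∈ S then (f i).strictPart else f i

theorem strictOn_le (S : Set (Fin n)) (f : Fin n → Fn) : strictOn S f ≤ f := fun i c a h => by
  unfold strictOn at h
  split_ifs at h
  · exact (Fn.mem_strictPart.mp h).1
  · exact h

theorem strictOn_mono {S : Set (Fin n)} {f g : Fin n → Fn} (h : f ≤ g) :
    strictOn S f ≤ strictOn S g := fun i c a ha => by
  unfold strictOn at ha ⊢
  split_ifs at ha ⊢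
  · obtain ⟨h1, h2⟩ := Fn.mem_strictPart.mp ha
    exact Fn.mem_strictPart.mpr ⟨h i c a h1, h2⟩
  · exact h i c a ha

theorem strictOn_strict {S : Set (Fin n)} {f : Fin n → Fn} {i : Fin n} (hi : i ∈ S) :
    ¬ (strictOn S f i ⊥).Dom := by
  simp only [strictOn, hi, if_true]
  exact Fn.strictPart_bot _

theorem strictOn_some (S : Set (Fin n)) (f : Fin n → Fn) (i : Fin n) (m : ℕ) :
    strictOn S f i (Part.some m) = f i (Part.some m) := by
  unfold strictOn
  split_ifs
  · exact Fn.strictPart_some _ _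
  · rfl

theorem strictOn_of_notMem {S : Set (Fin n)} {f : Fin n → Fn} {i : Fin n} (hi : i ∉ S) :
    strictOn S f i = f i := by
  simp [strictOn, hi]

theorem strictOn_insert {S : Set (Fin n)} {f : Fin n → Fn} {i : Fin n} (hi : ¬ (f i ⊥).Dom) :
    strictOn (insert i S) f = strictOn S f := by
  funext j
  by_cases hj : j = i
  · subst hj
    simp [strictOn, Fn.strictPart_eq hi]
  · simp [strictOn, hj]

/-- All values of strict components are at arguments in `D`. -/
def SupportedBy (f : Fin n → Fn) (D : Finset ℕ) : Prop :=
  ∀ i m, ¬ (f i ⊥).Dom → (f i (Part.some m)).Dom → m ∈ D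

theorem supportedBy_restrictAll (f : Fin n → Fn) (D : Finset ℕ) :
    SupportedBy (restrictAll f D) D := by
  intro i m h1 h2
  obtain ⟨-, h3⟩ := Fn.mem_restrict.mp (Part.get_mem h2)
  rcases h3 with h3 | ⟨m', h4, h5⟩
  · exact absurd (Fn.restrict_bot_dom.mpr h3) h1
  · rwa [Part.mem_some_iff.mp h5] at h4

theorem strictOn_eq_self {S : Set (Fin n)} {f : Fin n → Fn} (h : ∀ i ∈ S, ¬ (f i ⊥).Dom) :
    strictOn S f = f := by
  funext i
  by_cases hi : i ∈ S
  · simp [strictOn, hi, Fn.strictPart_eq (h i hi)]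
  · simp [strictOn, hi]

/-! ### Well-founded procedures -/

/-- The well-founded procedures. -/
inductive FinProc (n : ℕ) : Type
  | const (c : Option ℕ) : FinProc n
  | caseOf (i : Fin n) (Q : FinProc n) (P : ℕ → FinProc n) : FinProc n

namespace FinProc

/-- The value of a well-founded procedure. -/
def den (f : Fin n → Fn) : FinProc n → NBot
  | const c => (c : Part ℕ)
  | caseOf i Q P => (f i (den f Q)).bind fun a => den f (P a)

theorem mem_den_const {f : Fin n → Fn} {c : Option ℕ} {b : ℕ} :
    b ∈ den f (const c : FinProc n) ↔ c = some b := by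
  simp [den]

theorem mem_den_caseOf {f : Fin n → Fn} {i : Fin n} {Q : FinProc n} {P : ℕ → FinProc n} {b : ℕ} :
    b ∈ den f (caseOf i Q P) ↔ ∃ a ∈ f i (den f Q), b ∈ den f (P a) := by
  simp [den]

theorem den_mono {f g : Fin n → Fn} (h : f ≤ g) (w : FinProc n) : den f w ≤ den g w := by
  induction w with
  | const c => exact le_refl _
  | caseOf i Q P ihQ ihP =>
    intro b hb
    obtain ⟨a, ha, hb⟩ := mem_den_caseOf.mp hb
    exact mem_den_caseOf.mpr ⟨a, mem_of_le_fn (g i) ihQ (h i _ a ha), ihP a b hb⟩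

/-- Only finitely much of the arguments is used. -/
theorem exists_restrict {f : Fin n → Fn} {w : FinProc n} {b : ℕ} (h : b ∈ den f w) :
    ∃ D, b ∈ den (restrictAll f D) w := by
  induction w generalizing b with
  | const c => exact ⟨∅, h⟩
  | caseOf i Q P ihQ ihP =>
    obtain ⟨a, ha, hb⟩ := mem_den_caseOf.mp h
    obtain ⟨D, hD⟩ := ihP a hb
    by_cases hi : (f i ⊥).Dom
    · refine ⟨D, mem_den_caseOf.mpr ⟨a, ?_, hD⟩⟩
      -- A constant function survives every restriction, so the argument `Q` may stay undefined
      -- here.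
      exact Fn.mem_of_mem_bot (Fn.mem_restrict_bot.mpr (Fn.mem_bot_of_mem hi ha)) _
    · obtain ⟨m, hm⟩ := Fn.exists_mem_arg hi ha
      obtain ⟨D', hD'⟩ := ihQ hm
      refine ⟨insert m (D ∪ D'), mem_den_caseOf.mpr ⟨a, ?_, ?_⟩⟩
      · have h1 : m ∈ den (restrictAll f (insert m (D ∪ D'))) Q :=
          den_mono (restrictAll_mono (by grind)) Q _ hD'
        rw [eq_some_of_mem hm] at ha
        rw [eq_some_of_mem h1]
        exact Fn.mem_restrict_of_mem ha (Part.mem_some m) (by simp)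
      · exact den_mono (restrictAll_mono (by grind)) _ _ hD

/-- Sequential composition: the result of `w` is passed to `k`. -/
def bind : FinProc n → (ℕ → FinProc n) → FinProc n
  | const none, _ => const none
  | const (some m), k => k m
  | caseOf i Q P, k => caseOf i Q fun a => bind (P a) k

theorem mem_den_bind {f : Fin n → Fn} {w : FinProc n} {k : ℕ → FinProc n} {b : ℕ} :
    b ∈ den f (bind w k) ↔ ∃ m ∈ den f w, b ∈ den f (k m) := by
  induction w with
  | const c => cases c <;> simp [bind, mem_den_const]
  | caseOf i Q P _ ihP =>
    simp only [bind, mem_den_caseOf, ihP]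
    grind

end FinProc

/-! ### Finite approximations of procedures -/

/-- The procedure `P`, cut off at depth `d`. -/
noncomputable def Proc.trunc : ℕ → Proc n → FinProc n
  | 0, _ => .const none
  | d + 1, P =>
    match PFunctor.M.dest P with
    | ⟨Sum.inl c, _⟩ => .const c.toOption
    | ⟨Sum.inr i, k⟩ => .caseOf i (Proc.trunc d (k (none : Option ℕ)))
        fun a => Proc.trunc d (k (some a : Option ℕ))

theorem Proc.trunc_const (d : ℕ) (c : NBot) :
    Proc.trunc (d + 1) (Proc.const c : Proc n) = .const c.toOption :=
  rfl

theorem Proc.trunc_caseOf (d : ℕ) (i : Fin n) (Q : Proc n) (P : ℕ → Proc n) :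
    Proc.trunc (d + 1) (Proc.caseOf i Q P) =
      .caseOf i (Proc.trunc d Q) fun a => Proc.trunc d (P a) :=
  rfl

theorem Proc.eval_of_mem_trunc {f : Fin n → Fn} {d : ℕ} {P : Proc n} {b : ℕ}
    (h : b ∈ (Proc.trunc d P).den f) : Eval f P b := by
  induction d generalizing P b with
  | zero => exact absurd (FinProc.mem_den_const.mp h) (by simp)
  | succ d ih =>
    rcases Proc.cases P with ⟨c, rfl⟩ | ⟨i, Q, P, rfl⟩
    · rw [Proc.trunc_const, FinProc.mem_den_const] at h
      exact Eval.const c b (Part.mem_toOption.mp h)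
    · rw [Proc.trunc_caseOf, FinProc.mem_den_caseOf] at h
      obtain ⟨a, ha, hb⟩ := h
      exact Eval.caseOf i Q P _ a b (fun m hm => ih hm) ha (ih hb)

theorem Proc.exists_mem_trunc {f : Fin n → Fn} {P : Proc n} {b : ℕ} (h : Eval f P b) :
    ∃ d₀, ∀ d ≥ d₀, b ∈ (Proc.trunc d P).den f := by
  induction h with
  | const c a h =>
    refine ⟨1, fun d hd => ?_⟩
    obtain ⟨d, rfl⟩ := Nat.exists_eq_add_of_le' hd
    rw [Proc.trunc_const, FinProc.mem_den_const]
    exact Part.mem_toOption.mpr h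
  | caseOf i Q P c a b _ ha _ ihQ ihP =>
    obtain ⟨d₁, h₁⟩ := ihP
    -- If `c = ⊥`, the argument is never used and every depth suffices.
    obtain ⟨d₂, h₂⟩ : ∃ d₂, ∀ d ≥ d₂, c ≤ (Proc.trunc d Q).den f := by
      by_cases hc : c.Dom
      · obtain ⟨d₂, h₂⟩ := ihQ _ (Part.get_mem hc)
        refine ⟨d₂, fun d hd m hm => ?_⟩
        rw [Part.mem_unique hm (Part.get_mem hc)]
        exact h₂ d hd
      · exact ⟨0, fun d _ m hm => absurd hm.1 hc⟩
    refine ⟨max d₁ d₂ + 1, fun d hd => ?_⟩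
    obtain ⟨d, rfl⟩ := Nat.exists_eq_add_of_le' (le_trans (Nat.le_add_left 1 _) hd)
    rw [Proc.trunc_caseOf, FinProc.mem_den_caseOf]
    exact ⟨a, mem_of_le_fn (f i) (h₂ d (by omega)) ha, h₁ d (by omega)⟩

/-! ### Procedures from transition systems -/

/-- One step of a transition system: a procedure, or a query whose answers lead to new states. -/
inductive Step (n : ℕ) (X : Type) : Type
  | done (P : Proc n) : Step n X
  | query (i : Fin n) (Q : Proc n) (k : ℕ → X) : Step n X

/-- The coalgebra on states and procedures that is given by a transition system. -/
def unfoldStep {X : Type} (step : X → Step n X) : X ⊕ Proc n → (procSig n) (X ⊕ Proc n)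
  | Sum.inr P => (procSig n).map Sum.inr (PFunctor.M.dest P)
  | Sum.inl x =>
    match step x with
    | .done P => (procSig n).map Sum.inr (PFunctor.M.dest P)
    | .query i Q k =>
      ⟨Sum.inr i, fun o => Option.elim (show Option ℕ from o) (Sum.inr Q) fun a => Sum.inl (k a)⟩

/-- The procedure that runs a transition system. -/
def run {X : Type} (step : X → Step n X) (x : X) : Proc n :=
  PFunctor.M.corec (unfoldStep step) (Sum.inl x)

/-- Both sides, as functions of `P`, are coalgebra morphisms into the final coalgebra, hence equal.
-/
theorem corec_unfoldStep_inr {X : Type} (step : X → Step n X) (P : Proc n) :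
    PFunctor.M.corec (unfoldStep step) (Sum.inr P) = P := by
  have h1 := PFunctor.M.corec_unique (P := procSig n) PFunctor.M.dest
    (fun P => PFunctor.M.corec (unfoldStep step) (Sum.inr P)) fun P => by
      rw [PFunctor.M.dest_corec]
      rfl
  have h2 := PFunctor.M.corec_unique (P := procSig n) PFunctor.M.dest id fun P => rfl
  exact congrFun (h1.trans h2.symm) P

theorem run_of_done {X : Type} {step : X → Step n X} {x : X} {P : Proc n}
    (h : step x = .done P) : run step x = P := by
  have h1 : PFunctor.M.dest (run step x) =
      (procSig n).map (PFunctor.M.corec (unfoldStep step)) (unfoldStep step (Sum.inl x)) :=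
    PFunctor.M.dest_corec _ _
  have h2 : unfoldStep step (Sum.inl x) = (procSig n).map Sum.inr (PFunctor.M.dest P) := by
    simp only [unfoldStep, h]
  have h3 : (PFunctor.M.corec (unfoldStep step)) ∘ Sum.inr = id :=
    funext (corec_unfoldStep_inr step)
  rw [h2, PFunctor.map_map, h3, PFunctor.id_map] at h1
  rw [← PFunctor.M.mk_dest (run step x), h1, PFunctor.M.mk_dest]

theorem run_of_query {X : Type} {step : X → Step n X} {x : X} {i : Fin n} {Q : Proc n}
    {k : ℕ → X} (h : step x = .query i Q k) :
    run step x = Proc.caseOf i Q fun a => run step (k a) := by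
  rw [← PFunctor.M.mk_dest (run step x), run, PFunctor.M.dest_corec, unfoldStep, h, Proc.caseOf]
  refine congrArg PFunctor.M.mk (congrArg (Sigma.mk _) (funext fun o => ?_))
  cases (show Option ℕ from o) with
  | none => exact corec_unfoldStep_inr step Q
  | some a => rfl

theorem eval_const_iff {f : Fin n → Fn} {c : NBot} {b : ℕ} :
    Eval f (Proc.const c) b ↔ b ∈ c := by
  rw [← mem_denote, denote_const]

theorem eval_caseOf_iff {f : Fin n → Fn} {i : Fin n} {Q : Proc n} {P : ℕ → Proc n} {b : ℕ} :
    Eval f (Proc.caseOf i Q P) b ↔ ∃ a ∈ f i (denote Q f), Eval f (P a) b := by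
  rw [← mem_denote, denote_caseOf, Part.mem_bind_iff]
  simp only [mem_denote]

/-- An evaluation is a finite derivation, so an invariant can be carried back from its end to the
initial state. -/
theorem run_sound {X : Type} {step : X → Step n X} {f : Fin n → Fn} (Inv : X → ℕ → Prop)
    (hdone : ∀ x P b, step x = .done P → Eval f P b → Inv x b)
    (hquery : ∀ x i Q k, step x = .query i Q k → ∀ a ∈ f i (denote Q f), ∀ b,
      Inv (k a) b → Inv x b) {x : X} {b : ℕ}
    (h : Eval f (run step x) b) : Inv x b := by
  generalize hP : run step x = P at h
  induction h generalizing x with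
  | const c a h =>
    cases hs : step x with
    | done P =>
      rw [run_of_done hs] at hP
      exact hdone x P a hs (hP ▸ Eval.const c a h)
    | query i Q k =>
      rw [run_of_query hs] at hP
      exact absurd hP.symm Proc.const_ne_caseOf
  | caseOf i Q P c a b hQ ha hP' _ ihP =>
    cases hs : step x with
    | done P =>
      rw [run_of_done hs] at hP
      exact hdone x P b hs (hP ▸ Eval.caseOf i Q _ c a b hQ ha hP')
    | query j R k =>
      rw [run_of_query hs] at hP
      obtain ⟨rfl, rfl, rfl⟩ := Proc.caseOf_inj hP
      refine hquery x j R k hs a ?_ b (ihP rfl)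
      exact mem_of_le_fn (f j) (fun m hm => mem_denote.mpr (hQ m hm)) ha

/-- The transition system for the sequential composition of procedures. -/
noncomputable def bindStep (k : ℕ → Proc n) (P : Proc n) : Step n (Proc n) :=
  match PFunctor.M.dest P with
  | ⟨Sum.inl c, _⟩ => .done (if h : c.Dom then k (c.get h) else Proc.const ⊥)
  | ⟨Sum.inr i, r⟩ => .query i (r (none : Option ℕ)) fun a => r (some a : Option ℕ)

theorem bindStep_const (k : ℕ → Proc n) (c : NBot) : bindStep k (Proc.const c) =
    .done (if h : c.Dom then k (c.get h) else Proc.const ⊥) :=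
  rfl

theorem bindStep_caseOf (k : ℕ → Proc n) (i : Fin n) (Q : Proc n) (P : ℕ → Proc n) :
    bindStep k (Proc.caseOf i Q P) = .query i Q P :=
  rfl

/-- Sequential composition: the result of `P` is passed to `k`. -/
noncomputable def Proc.bind (P : Proc n) (k : ℕ → Proc n) : Proc n := run (bindStep k) P

theorem eval_bind_iff {f : Fin n → Fn} {P : Proc n} {k : ℕ → Proc n} {b : ℕ} :
    Eval f (P.bind k) b ↔ ∃ m, Eval f P m ∧ Eval f (k m) b := by
  constructor
  · refine run_sound (fun P b => ∃ m, Eval f P m ∧ Eval f (k m) b) ?_ ?_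
    · intro P R b hs hR
      rcases Proc.cases P with ⟨c, rfl⟩ | ⟨i, Q, P, rfl⟩
      · rw [bindStep_const] at hs
        obtain rfl := Step.done.inj hs
        split_ifs at hR with h
        · exact ⟨_, Eval.const c _ (Part.get_mem h), hR⟩
        · exact absurd (eval_const_iff.mp hR) not_mem_bot
      · rw [bindStep_caseOf] at hs
        cases hs
    · intro P j R r hs a ha b
      rcases Proc.cases P with ⟨c, rfl⟩ | ⟨i, Q, P, rfl⟩
      · rw [bindStep_const] at hs
        cases hs
      · rw [bindStep_caseOf] at hs
        cases hs
        rintro ⟨m, hm, hb⟩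
        exact ⟨m, eval_caseOf_iff.mpr ⟨a, ha, hm⟩, hb⟩
  · rintro ⟨m, hm, hb⟩
    induction hm with
    | const c m h =>
      rw [Proc.bind, run_of_done (bindStep_const k c), dif_pos h.1]
      rwa [← h.2] at hb
    | caseOf i Q P c a m hQ ha _ _ ihP =>
      rw [Proc.bind, run_of_query (bindStep_caseOf k i Q P)]
      exact Eval.caseOf i Q _ c a b hQ ha (ihP hb)

/-! ### Normal forms for arguments that are strict in `S` -/

/-- Well-founded procedures whose queries to variables in `S` have numbers as arguments. -/
inductive NormalForm (S : Set (Fin n)) : Type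
  | ret (c : Option ℕ) : NormalForm S
  | ask (j : Fin n) (hj : j ∈ S) (m : ℕ) (k : ℕ → NormalForm S) : NormalForm S
  | call (j : Fin n) (hj : j ∉ S) (R : FinProc n) (k : ℕ → NormalForm S) : NormalForm S

namespace NormalForm

variable {S : Set (Fin n)}

/-- The value of a normal form. -/
def den (f : Fin n → Fn) : NormalForm S → NBot
  | ret c => (c : Part ℕ)
  | ask j _ m k => (f j (Part.some m)).bind fun a => den f (k a)
  | call j _ R k => (f j (R.den f)).bind fun a => den f (k a)

theorem mem_den_ret {f : Fin n → Fn} {c : Option ℕ} {b : ℕ} :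
    b ∈ den f (ret c : NormalForm S) ↔ c = some b := by
  simp [den]

theorem mem_den_ask {f : Fin n → Fn} {j : Fin n} {hj : j ∈ S} {m : ℕ} {k : ℕ → NormalForm S}
    {b : ℕ} : b ∈ den f (ask j hj m k) ↔ ∃ a ∈ f j (Part.some m), b ∈ den f (k a) := by
  simp [den]

theorem mem_den_call {f : Fin n → Fn} {j : Fin n} {hj : j ∉ S} {R : FinProc n}
    {k : ℕ → NormalForm S} {b : ℕ} :
    b ∈ den f (call j hj R k) ↔ ∃ a ∈ f j (R.den f), b ∈ den f (k a) := by
  simp [den]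

theorem den_mono {f g : Fin n → Fn} (h : f ≤ g) (E : NormalForm S) : den f E ≤ den g E := by
  induction E with
  | ret c => exact le_refl _
  | ask j hj m k ih =>
    intro b hb
    obtain ⟨a, ha, hb⟩ := mem_den_ask.mp hb
    exact mem_den_ask.mpr ⟨a, h j _ a ha, ih a b hb⟩
  | call j hj R k ih =>
    intro b hb
    obtain ⟨a, ha, hb⟩ := mem_den_call.mp hb
    exact mem_den_call.mpr ⟨a, mem_of_le_fn (g j) (R.den_mono h) (h j _ a ha), ih a b hb⟩

/-- Sequential composition: the result of `E` is passed to `k`. -/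
def bind : NormalForm S → (ℕ → NormalForm S) → NormalForm S
  | ret none, _ => ret none
  | ret (some m), k => k m
  | ask j hj m r, k => ask j hj m fun a => bind (r a) k
  | call j hj R r, k => call j hj R fun a => bind (r a) k

theorem mem_den_bind {f : Fin n → Fn} {E : NormalForm S} {k : ℕ → NormalForm S} {b : ℕ} :
    b ∈ den f (bind E k) ↔ ∃ m ∈ den f E, b ∈ den f (k m) := by
  induction E with
  | ret c => cases c <;> simp [bind, mem_den_ret]
  | ask j hj m r ih =>
    simp only [bind, mem_den_ask, ih]
    grind
  | call j hj R r ih =>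
    simp only [bind, mem_den_call, ih]
    grind

end NormalForm

/-- The normal form of a well-founded procedure. -/
noncomputable def FinProc.normalize (S : Set (Fin n)) : FinProc n → NormalForm S
  | .const c => .ret c
  | .caseOf i Q P =>
    if hi : i ∈ S then
      (FinProc.normalize S Q).bind fun m => .ask i hi m fun a => FinProc.normalize S (P a)
    else .call i hi Q fun a => FinProc.normalize S (P a)

/-- A strict variable answers only at proper numbers, so evaluating its argument beforehand loses no
value. -/
theorem FinProc.mem_den_normalize {S : Set (Fin n)} {f : Fin n → Fn}
    (hf : ∀ i ∈ S, ¬ (f i ⊥).Dom) {w : FinProc n} {b : ℕ} :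
    b ∈ (w.normalize S).den f ↔ b ∈ w.den f := by
  induction w generalizing b with
  | const c => rw [normalize, NormalForm.mem_den_ret, mem_den_const]
  | caseOf i Q P ihQ ihP =>
    rw [normalize, mem_den_caseOf]
    split_ifs with hi
    · simp only [NormalForm.mem_den_bind, NormalForm.mem_den_ask, ihQ, ihP]
      constructor
      · rintro ⟨m, hm, a, ha, hb⟩
        exact ⟨a, eq_some_of_mem hm ▸ ha, hb⟩
      · rintro ⟨a, ha, hb⟩
        obtain ⟨m, hm⟩ := Fn.exists_mem_arg (hf i hi) ha
        exact ⟨m, hm, a, eq_some_of_mem hm ▸ ha, hb⟩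
    · simp only [NormalForm.mem_den_call, ihP]

/-! ### Skipping queries with known answers, and testing these answers -/

namespace NormalForm

variable {S : Set (Fin n)}

/-- The part of a normal form after all queries with known answers: `p` holds the answers of
variables at numbers, and `a` those of the variables taken to be constant. -/
def follow (p : Fin n → ℕ → Option ℕ) (a : Fin n → Option ℕ) : NormalForm S → NormalForm S
  | ret c => ret c
  | ask j hj m k =>
    match p j m with
    | none => ask j hj m k
    | some v => follow p a (k v)
  | call j hj R k =>
    match a j with
    | none => call j hj R k
    | some v => follow p a (k v)

/-- The search for the first query that is not answered according to `p` and `a`. The result is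
`m + 1` if this is a query to `x_i` at `m`, and `0` if it is a query to another variable or
there is none before the end of the known part. -/
noncomputable def deviation (p : Fin n → ℕ → Option ℕ) (a : Fin n → Option ℕ) (i : Fin n) :
    NormalForm S → FinProc n
  | ret _ => .const (some 0)
  | ask j _ m k =>
    match p j m with
    | none => .const (some 0)
    | some v => deviation p a i (k v)
  | call j _ R k =>
    match a j with
    | none => .const (some 0)
    | some v =>
      if j = i then
        -- Evaluating `R` first is harmless when `x_i` is strict, and it provides the number `m` to
        -- report.
        R.bind fun m => .caseOf i (.const (some m)) fun b =>
          if b = v then deviation p a i (k v) else .const (some (m + 1))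
      else .caseOf j R fun b => if b = v then deviation p a i (k v) else .const (some 0)

variable {p : Fin n → ℕ → Option ℕ} {a : Fin n → Option ℕ} {f : Fin n → Fn}

/-- The next question is always a new one; this makes `rank` decrease. -/
theorem follow_eq_ask {E : NormalForm S} {j : Fin n} {hj : j ∈ S} {m : ℕ}
    {k : ℕ → NormalForm S} (h : follow p a E = ask j hj m k) : p j m = none := by
  induction E with
  | ret c => cases h
  | ask j' hj' m' k' ih =>
    rw [follow] at h
    split at h
    · cases h
      assumption
    · exact ih _ h
  | call j' hj' R k' ih =>
    rw [follow] at h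
    split at h
    · cases h
    · exact ih _ h

theorem follow_eq_call {E : NormalForm S} {j : Fin n} {hj : j ∉ S} {R : FinProc n}
    {k : ℕ → NormalForm S} (h : follow p a E = call j hj R k) : a j = none := by
  induction E with
  | ret c => cases h
  | ask j' hj' m' k' ih =>
    rw [follow] at h
    split at h
    · cases h
    · exact ih _ h
  | call j' hj' R k' ih =>
    rw [follow] at h
    split at h
    · cases h
      assumption
    · exact ih _ h

/-- A positive result is returned only after `x_i` itself has given a wrong answer at that number.
-/
theorem deviation_succ {E : NormalForm S} {i : Fin n} {m : ℕ}
    (h : m + 1 ∈ (deviation p a i E).den f) :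
    ∃ v b, a i = some v ∧ b ∈ f i (Part.some m) ∧ b ≠ v := by
  induction E with
  | ret c => simp [deviation, FinProc.mem_den_const] at h
  | ask j hj m' k ih =>
    rw [deviation] at h
    split at h
    · simp [FinProc.mem_den_const] at h
    · exact ih _ h
  | call j hj R k ih =>
    rw [deviation] at h
    split at h
    · simp [FinProc.mem_den_const] at h
    · rename_i v hv
      split_ifs at h with hji
      · subst hji
        obtain ⟨m', hm', h⟩ := FinProc.mem_den_bind.mp h
        obtain ⟨b, hb, h⟩ := FinProc.mem_den_caseOf.mp h
        split_ifs at h with hbv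
        · exact ih _ h
        · have : m' = m := by simpa [FinProc.mem_den_const] using h
          subst this
          refine ⟨v, b, hv, ?_, hbv⟩
          simpa [FinProc.den] using hb
      · obtain ⟨b, hb, h⟩ := FinProc.mem_den_caseOf.mp h
        split_ifs at h with hbv
        · exact ih _ h
        · simp [FinProc.mem_den_const] at h

/-- The search makes only queries that the evaluation of `E` makes as well, and strictness of `x_i`
yields the numbers it needs; so it ends whenever `E` has a value. -/
theorem exists_mem_deviation {E : NormalForm S} {i : Fin n} (hi : ¬ (f i ⊥).Dom)
    (hp : ∀ j m v, p j m = some v → v ∈ f j (Part.some m)) {b : ℕ} (h : b ∈ E.den f) :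
    ∃ t, t ∈ (deviation p a i E).den f := by
  induction E with
  | ret c => exact ⟨0, by simp [deviation, FinProc.mem_den_const]⟩
  | ask j hj m' k ih =>
    rw [deviation]
    split
    · exact ⟨0, by simp [FinProc.mem_den_const]⟩
    · rename_i v hv
      obtain ⟨c, hc, h⟩ := mem_den_ask.mp h
      rw [Part.mem_unique hc (hp _ _ _ hv)] at h
      exact ih _ h
  | call j hj R k ih =>
    rw [deviation]
    split
    · exact ⟨0, by simp [FinProc.mem_den_const]⟩
    · rename_i v hv
      obtain ⟨c, hc, h⟩ := mem_den_call.mp h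
      split_ifs with hji
      · subst hji
        obtain ⟨m, hm⟩ := Fn.exists_mem_arg hi hc
        simp only [FinProc.mem_den_bind, FinProc.mem_den_caseOf]
        rw [eq_some_of_mem hm] at hc
        by_cases hcv : c = v
        · subst hcv
          obtain ⟨t, ht⟩ := ih _ h
          exact ⟨t, m, hm, c, by simpa [FinProc.den] using hc, by simpa using ht⟩
        · exact ⟨m + 1, m, hm, c, by simpa [FinProc.den] using hc,
            by simp [hcv, FinProc.mem_den_const]⟩
      · simp only [FinProc.mem_den_caseOf]
        by_cases hcv : c = v
        · subst hcv
          obtain ⟨t, ht⟩ := ih _ h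
          exact ⟨t, c, hc, by simpa using ht⟩
        · exact ⟨0, c, hc, by simp [hcv, FinProc.mem_den_const]⟩

/-- No skipped query can be the first with a wrong answer: a strict variable making it would have a
positive search result. Hence every skipped answer is the true one. -/
theorem den_follow {E : NormalForm S} (hp : ∀ j m v, p j m = some v → v ∈ f j (Part.some m))
    (ha : ∀ i v, a i = some v →
      v ∈ f i ⊥ ∨ (¬ (f i ⊥).Dom ∧ 0 ∈ (deviation p a i E).den f)) :
    (follow p a E).den f = E.den f := by
  induction E with
  | ret c => rfl
  | ask j hj m k ih =>
    cases hv : p j m with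
    | none => simp only [follow, hv]
    | some v =>
      simp only [follow, deviation, hv] at ha ⊢
      rw [ih v ha]
      ext b
      rw [mem_den_ask]
      exact ⟨fun h => ⟨v, hp _ _ _ hv, h⟩,
        fun ⟨c, hc, h⟩ => Part.mem_unique hc (hp _ _ _ hv) ▸ h⟩
  | call j hj R k ih =>
    cases hv : a j with
    | none => simp only [follow, hv]
    | some v =>
      simp only [follow, hv]
      have key : v ∈ f j (R.den f) := by
        rcases ha j v hv with h | ⟨h1, h2⟩
        · exact Fn.mem_of_mem_bot h _
        · simp only [deviation, hv, if_true] at h2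
          obtain ⟨m, hm, h2⟩ := FinProc.mem_den_bind.mp h2
          obtain ⟨b, hb, h2⟩ := FinProc.mem_den_caseOf.mp h2
          split_ifs at h2 with hbv
          · subst hbv
            rw [eq_some_of_mem hm]
            simpa [FinProc.den] using hb
          · simp [FinProc.mem_den_const] at h2
      rw [ih v]
      · ext b
        rw [mem_den_call]
        exact ⟨fun h => ⟨v, key, h⟩, fun ⟨c, hc, h⟩ => Part.mem_unique hc key ▸ h⟩
      -- As the answer of `x_j` is now known to be `v`, the search for every `x_i` passes this query
      -- and continues with `k v`.
      · intro i w hw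
        refine (ha i w hw).imp_right fun ⟨h1, h2⟩ => ⟨h1, ?_⟩
        simp only [deviation, hv] at h2
        split_ifs at h2 with hji
        · obtain ⟨m, hm, h2⟩ := FinProc.mem_den_bind.mp h2
          obtain ⟨b, hb, h2⟩ := FinProc.mem_den_caseOf.mp h2
          split_ifs at h2 with hbv
          · exact h2
          · simp [FinProc.mem_den_const] at h2
        · obtain ⟨b, hb, h2⟩ := FinProc.mem_den_caseOf.mp h2
          rw [Part.mem_unique hb key] at h2
          simpa using h2

/-- The first query of `E` is to `x_j` at the number `m`. -/
def IsAsk (j : Fin n) (m : ℕ) (E : NormalForm S) : Prop := ∃ hj k, E = ask j hj m k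

/-- The first query of `E` is to `x_j`, where `j` is not in `S`. -/
def IsCall (j : Fin n) (E : NormalForm S) : Prop := ∃ hj R k, E = call j hj R k

/-- The argument of the first query. -/
def arg : NormalForm S → FinProc n
  | call _ _ R _ => R
  | _ => .const none

/-- The continuation after the answer `v` to the first query. -/
def next (v : ℕ) : NormalForm S → NormalForm S
  | ask _ _ _ k => k v
  | call _ _ _ k => k v
  | ret _ => ret none

theorem IsAsk.mem_den {E : NormalForm S} {j : Fin n} {m : ℕ} (h : E.IsAsk j m) {b : ℕ} :
    b ∈ E.den f ↔ ∃ v ∈ f j (Part.some m), b ∈ (E.next v).den f := by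
  obtain ⟨hj, k, rfl⟩ := h
  exact mem_den_ask

theorem IsCall.mem_den {E : NormalForm S} {j : Fin n} (h : E.IsCall j) {b : ℕ} :
    b ∈ E.den f ↔ ∃ v ∈ f j (E.arg.den f), b ∈ (E.next v).den f := by
  obtain ⟨hj, R, k, rfl⟩ := h
  exact mem_den_call

end NormalForm

variable {I : Type} {𝒰 : Ultrafilter I}

/-! ### Limits along an ultrafilter -/

/-- The continuous limit of a family of functionals along an ultrafilter, as a relation between
arguments and values. -/
def Lim (𝒰 : Ultrafilter I) (φ : I → Functional n) (f : Fin n → Fn) (b : ℕ) : Prop :=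
  ∃ D, ∀ᶠ k in 𝒰, b ∈ φ k (restrictAll f D)

theorem Lim.exists_superset {φ : I → Functional n} (hφ : ∀ k, Monotone (φ k)) {f : Fin n → Fn}
    {b : ℕ} (h : Lim 𝒰 φ f b) : ∃ D₀, ∀ D, D₀ ⊆ D → ∀ᶠ k in 𝒰, b ∈ φ k (restrictAll f D) := by
  obtain ⟨D₀, h⟩ := h
  exact ⟨D₀, fun D hD => h.mono fun k hk => hφ k (restrictAll_mono hD) b hk⟩

theorem Lim.exists_restrict {φ : I → Functional n} {f : Fin n → Fn} {b : ℕ} (h : Lim 𝒰 φ f b) :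
    ∃ D, Lim 𝒰 φ (restrictAll f D) b := by
  obtain ⟨D, h⟩ := h
  exact ⟨D, D, by rwa [restrictAll_restrictAll]⟩

/-- By monotonicity a witnessing restriction can be enlarged, so it suffices to compare at large
ones. -/
theorem lim_congr {φ ψ : I → Functional n} (hφ : ∀ k, Monotone (φ k)) (hψ : ∀ k, Monotone (ψ k))
    {f : Fin n → Fn} {b : ℕ} {D₀ : Finset ℕ}
    (h : ∀ D, D₀ ⊆ D → ∀ᶠ k in 𝒰, b ∈ φ k (restrictAll f D) ↔ b ∈ ψ k (restrictAll f D)) :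
    Lim 𝒰 φ f b ↔ Lim 𝒰 ψ f b := by
  constructor
  · intro hb
    obtain ⟨D₁, h₁⟩ := hb.exists_superset hφ
    refine ⟨D₀ ∪ D₁, ?_⟩
    filter_upwards [h _ Finset.subset_union_left, h₁ _ Finset.subset_union_right] with k h2 h3
    exact h2.mp h3
  · intro hb
    obtain ⟨D₁, h₁⟩ := hb.exists_superset hψ
    refine ⟨D₀ ∪ D₁, ?_⟩
    filter_upwards [h _ Finset.subset_union_left, h₁ _ Finset.subset_union_right] with k h2 h3
    exact h2.mpr h3

/-- The pigeonhole principle for ultrafilters, which makes the members of a family agree on one of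
finitely many options. -/
theorem eventually_exists_mem {β : Type*} {s : Set β} (hs : s.Finite) {p : I → β → Prop}
    (h : ∀ᶠ k in 𝒰, ∃ t ∈ s, p k t) : ∃ t ∈ s, ∀ᶠ k in 𝒰, p k t := by
  have h' : (⋃ t ∈ s, {k | p k t}) ∈ 𝒰 := by
    filter_upwards [h] with k ⟨t, ht, hk⟩
    exact Set.mem_biUnion ht hk
  exact (Ultrafilter.finite_biUnion_mem_iff hs).mp h'

namespace NormalForm

variable {S : Set (Fin n)}

/-- The limit of a family of normal forms. -/
abbrev LimN (𝒰 : Ultrafilter I) (E : I → NormalForm S) : (Fin n → Fn) → ℕ → Prop :=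
  Lim 𝒰 fun k f => (E k).den f

theorem monotone_den (E : NormalForm S) : Monotone fun f => E.den f := fun _ _ h => E.den_mono h

end NormalForm

/-- The limit of a family of well-founded procedures. -/
abbrev LimP (𝒰 : Ultrafilter I) (P : I → FinProc n) : (Fin n → Fn) → ℕ → Prop :=
  Lim 𝒰 fun k f => (P k).den f

theorem FinProc.monotone_den (P : FinProc n) : Monotone fun f => P.den f :=
  fun _ _ h => P.den_mono h

/-! ### Limits of normal forms at arguments that are strict in `S` -/

section Strict

variable {S : Set (Fin n)} {g : Fin n → Fn}

open NormalForm

theorem restrictAll_strict {i : Fin n} (h : ¬ (g i ⊥).Dom) (D : Finset ℕ) :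
    ¬ (restrictAll g D i ⊥).Dom := fun h' => h (Fn.restrict_bot_dom.mp h')

theorem mem_restrictAll_some {D : Finset ℕ} {j : Fin n} {m v : ℕ} (hm : m ∈ D)
    (h : v ∈ g j (Part.some m)) : v ∈ restrictAll g D j (Part.some m) :=
  Fn.mem_restrict_of_mem h (Part.mem_some m) hm

theorem limP_normalize_iff (hg : ∀ i ∈ S, ¬ (g i ⊥).Dom) {P : I → FinProc n} {b : ℕ} :
    LimN 𝒰 (fun k => (P k).normalize S) g b ↔ LimP 𝒰 P g b := by
  refine lim_congr (D₀ := ∅) (fun _ => monotone_den _) (fun _ => FinProc.monotone_den _)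
    fun D _ => Eventually.of_forall fun k => ?_
  exact FinProc.mem_den_normalize fun i hi => restrictAll_strict (hg i hi) D

variable {E : I → NormalForm S} {p : Fin n → ℕ → Option ℕ} {a : Fin n → Option ℕ}

/-- There are finitely many variables, so one restriction is large enough to keep the recorded
answers and to witness all tests at once. -/
theorem limN_follow_iff (hp : ∃ D : Finset ℕ, ∀ j m v, p j m = some v →
      m ∈ D ∧ v ∈ g j (Part.some m))
    (ha : ∀ i v, a i = some v → v ∈ g i ⊥ ∨
      (¬ (g i ⊥).Dom ∧ LimP 𝒰 (fun k => (E k).deviation p a i) g 0)) {b : ℕ} :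
    LimN 𝒰 (fun k => (E k).follow p a) g b ↔ LimN 𝒰 E g b := by
  obtain ⟨D₀, hp⟩ := hp
  have h1 : ∀ i : Fin n, ∃ D₁ : Finset ℕ, ∀ D, D₁ ⊆ D → ∀ v, a i = some v → v ∈ g i ⊥ ∨
      (¬ (g i ⊥).Dom ∧ ∀ᶠ k in 𝒰, 0 ∈ ((E k).deviation p a i).den (restrictAll g D)) := by
    intro i
    cases hv : a i with
    | none => exact ⟨∅, by simp⟩
    | some v =>
      rcases ha i v hv with h | ⟨h1, h2⟩
      · exact ⟨∅, fun D _ w hw => Or.inl (Option.some.inj hw ▸ h)⟩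
      · obtain ⟨D₁, h⟩ := h2.exists_superset fun _ => FinProc.monotone_den _
        exact ⟨D₁, fun D hD w _ => Or.inr ⟨h1, h D hD⟩⟩
  choose D₁ h1 using h1
  refine lim_congr (D₀ := D₀ ∪ Finset.univ.biUnion D₁) (fun _ => monotone_den _)
    (fun _ => monotone_den _) fun D hD => ?_
  have h2 : ∀ i : Fin n, ∀ᶠ k in 𝒰, ∀ v, a i = some v → v ∈ restrictAll g D i ⊥ ∨
      (¬ (restrictAll g D i ⊥).Dom ∧
        0 ∈ ((E k).deviation p a i).den (restrictAll g D)) := by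
    intro i
    have hD1 : D₁ i ⊆ D := fun m hm => hD (by simp; exact Or.inr ⟨i, hm⟩)
    cases hv : a i with
    | none => simp
    | some v =>
      rcases h1 i D hD1 v hv with h | ⟨h3, h4⟩
      · refine Eventually.of_forall fun k w hw => Or.inl ?_
        exact Fn.mem_restrict_bot.mpr (Option.some.inj hw ▸ h)
      · exact h4.mono fun k hk w _ => Or.inr ⟨restrictAll_strict h3 D, hk⟩
  filter_upwards [eventually_all.mpr h2] with k hk
  rw [den_follow (fun j m v hv => mem_restrictAll_some
    (hD (Finset.mem_union_left _ (hp j m v hv).1)) (hp j m v hv).2) hk]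

theorem limP_deviation_succ {i : Fin n} {m : ℕ}
    (h : LimP 𝒰 (fun k => (E k).deviation p a i) g (m + 1)) :
    ∃ v b, a i = some v ∧ b ∈ g i (Part.some m) ∧ b ≠ v := by
  obtain ⟨D, h⟩ := h
  obtain ⟨k, hk⟩ := h.exists
  obtain ⟨v, b, h1, h2, h3⟩ := deviation_succ hk
  exact ⟨v, b, h1, restrictAll_le g D i _ b h2, h3⟩

theorem exists_limP_deviation {i : Fin n} (hi : ¬ (g i ⊥).Dom)
    (hp : ∃ D : Finset ℕ, ∀ j m v, p j m = some v → m ∈ D ∧ v ∈ g j (Part.some m)) {b : ℕ}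
    (h : LimN 𝒰 E g b) : ∃ t, LimP 𝒰 (fun k => (E k).deviation p a i) g t := by
  obtain ⟨D₀, hp⟩ := hp
  obtain ⟨D₁, h⟩ := h.exists_superset fun _ => monotone_den _
  -- A positive result is the successor of a number at which the restricted `x_i` has a value, so
  -- the possible results form a finite set.
  have key : ∀ᶠ k in 𝒰, ∃ t ∈ (insert 0 ((D₀ ∪ D₁).image Nat.succ) : Finset ℕ),
      t ∈ ((E k).deviation p a i).den (restrictAll g (D₀ ∪ D₁)) := by
    filter_upwards [h _ Finset.subset_union_right] with k hk
    obtain ⟨t, ht⟩ := exists_mem_deviation (a := a) (restrictAll_strict hi _)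
      (fun j m v hv => mem_restrictAll_some
        (Finset.mem_union_left D₁ (hp j m v hv).1) (hp j m v hv).2) hk
    refine ⟨t, ?_, ht⟩
    cases t with
    | zero => simp
    | succ m =>
      obtain ⟨v, b, -, h2, -⟩ := deviation_succ ht
      have := supportedBy_restrictAll g _ i m (restrictAll_strict hi _) h2.1
      simpa using this
  obtain ⟨t, -, ht⟩ := eventually_exists_mem (Finset.finite_toSet _) key
  exact ⟨t, _, ht⟩

/-- A restricted strict variable answers only at numbers in `D`, so a normal form with a value has
one of finitely many kinds of head. -/
theorem exists_head (hg : ∀ i ∈ S, ¬ (g i ⊥).Dom) {b : ℕ} (h : LimN 𝒰 E g b) :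
    (∃ v, ∀ᶠ k in 𝒰, E k = ret (some v)) ∨
      (∃ q : Fin n × ℕ, ∀ᶠ k in 𝒰, (E k).IsAsk q.1 q.2) ∨ ∃ j, ∀ᶠ k in 𝒰, (E k).IsCall j := by
  obtain ⟨D, h⟩ := h
  have key : ∀ᶠ k in 𝒰, E k = ret (some b) ∨
      (∃ q ∈ ((Finset.univ ×ˢ D : Finset (Fin n × ℕ)) : Set (Fin n × ℕ)), (E k).IsAsk q.1 q.2) ∨
      ∃ j ∈ (Set.univ : Set (Fin n)), (E k).IsCall j := by
    filter_upwards [h] with k hk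
    cases hE : E k with
    | ret c =>
      rw [hE] at hk
      exact Or.inl (by rw [mem_den_ret.mp hk])
    | ask j hj m r =>
      rw [hE] at hk
      obtain ⟨v, hv, -⟩ := mem_den_ask.mp hk
      have := supportedBy_restrictAll g D j m (restrictAll_strict (hg j hj) D) hv.1
      exact Or.inr (Or.inl ⟨(j, m), by simpa using this, hj, r, rfl⟩)
    | call j hj R r => exact Or.inr (Or.inr ⟨j, trivial, hj, R, r, rfl⟩)
  rw [Ultrafilter.eventually_or, Ultrafilter.eventually_or] at key
  refine key.imp (fun h => ⟨b, h⟩) (Or.imp (fun h => ?_) fun h => ?_)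
  · obtain ⟨q, -, hq⟩ := eventually_exists_mem (Finset.finite_toSet _) h
    exact ⟨q, hq⟩
  · obtain ⟨j, -, hj⟩ := eventually_exists_mem Set.finite_univ h
    exact ⟨j, hj⟩

theorem limN_ret_iff {v b : ℕ} (h : ∀ᶠ k in 𝒰, E k = ret (some v)) :
    LimN 𝒰 E g b ↔ v = b := by
  constructor
  · rintro ⟨D, hD⟩
    obtain ⟨k, h1, h2⟩ := (h.and hD).exists
    simp only [h1, mem_den_ret] at h2
    exact Option.some.inj h2
  · rintro rfl
    refine ⟨∅, h.mono fun k hk => ?_⟩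
    simp only [hk, mem_den_ret]

theorem limN_ask_iff {j : Fin n} {m v b : ℕ} (h : ∀ᶠ k in 𝒰, (E k).IsAsk j m)
    (hv : v ∈ g j (Part.some m)) : LimN 𝒰 (fun k => (E k).next v) g b ↔ LimN 𝒰 E g b := by
  refine lim_congr (D₀ := {m}) (fun _ => monotone_den _) (fun _ => monotone_den _) fun D hD => ?_
  filter_upwards [h] with k hk
  have hv' := mem_restrictAll_some (hD (by simp)) hv
  rw [hk.mem_den]
  exact ⟨fun hb => ⟨v, hv', hb⟩, fun ⟨w, hw, hb⟩ => Part.mem_unique hw hv' ▸ hb⟩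

theorem exists_mem_of_limN_ask {j : Fin n} {m b : ℕ} (h : ∀ᶠ k in 𝒰, (E k).IsAsk j m)
    (hb : LimN 𝒰 E g b) : ∃ v, v ∈ g j (Part.some m) := by
  obtain ⟨D, hD⟩ := hb
  obtain ⟨k, h1, h2⟩ := (h.and hD).exists
  obtain ⟨v, hv, -⟩ := h1.mem_den.mp h2
  exact ⟨v, restrictAll_le g D j _ v hv⟩

theorem limN_call_iff {j : Fin n} {v b : ℕ} (h : ∀ᶠ k in 𝒰, (E k).IsCall j)
    (hv : v ∈ g j ⊥ ∨ ∃ r, LimP 𝒰 (fun k => (E k).arg) g r ∧ v ∈ g j (Part.some r)) :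
    LimN 𝒰 (fun k => (E k).next v) g b ↔ LimN 𝒰 E g b := by
  obtain ⟨D₀, hD₀⟩ : ∃ D₀, ∀ D, D₀ ⊆ D → ∀ᶠ k in 𝒰,
      v ∈ restrictAll g D j ((E k).arg.den (restrictAll g D)) := by
    rcases hv with hv | ⟨r, hr, hv⟩
    · exact ⟨∅, fun D _ => Eventually.of_forall fun k =>
        Fn.mem_of_mem_bot (Fn.mem_restrict_bot.mpr hv) _⟩
    · obtain ⟨D₀, h₀⟩ := hr.exists_superset fun _ => FinProc.monotone_den _
      refine ⟨insert r D₀, fun D hD => ?_⟩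
      filter_upwards [h₀ D ((Finset.subset_insert r D₀).trans hD)] with k hk
      rw [eq_some_of_mem hk]
      exact mem_restrictAll_some (hD (Finset.mem_insert_self r D₀)) hv
  refine lim_congr (D₀ := D₀) (fun _ => monotone_den _) (fun _ => monotone_den _) fun D hD => ?_
  filter_upwards [h, hD₀ D hD] with k hk hv'
  rw [hk.mem_den]
  exact ⟨fun hb => ⟨v, hv', hb⟩, fun ⟨w, hw, hb⟩ => Part.mem_unique hw hv' ▸ hb⟩

/-- The restricted strict `x_j` answers only at arguments in `D`, and the ultrafilter selects one of
them. -/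
theorem exists_mem_of_limN_call {j : Fin n} (hj : ¬ (g j ⊥).Dom) {b : ℕ}
    (h : ∀ᶠ k in 𝒰, (E k).IsCall j) (hb : LimN 𝒰 E g b) :
    ∃ r, LimP 𝒰 (fun k => (E k).arg) g r ∧ ∃ v, v ∈ g j (Part.some r) := by
  obtain ⟨D, hD⟩ := hb
  have key : ∀ᶠ k in 𝒰, ∃ r ∈ (D : Set ℕ), r ∈ (E k).arg.den (restrictAll g D) ∧
      ∃ v, v ∈ g j (Part.some r) := by
    filter_upwards [h, hD] with k h1 h2
    obtain ⟨v, hv, -⟩ := h1.mem_den.mp h2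
    obtain ⟨r, hr⟩ := Fn.exists_mem_arg (restrictAll_strict hj D) hv
    rw [eq_some_of_mem hr] at hv
    exact ⟨r, supportedBy_restrictAll g D j r (restrictAll_strict hj D) hv.1, hr, v,
      restrictAll_le g D j _ v hv⟩
  obtain ⟨r, -, hr⟩ := eventually_exists_mem (Finset.finite_toSet D) key
  obtain ⟨k, hk⟩ := hr.exists
  exact ⟨r, ⟨D, hr.mono fun k hk => hk.1⟩, hk.2⟩

end Strict

/-! ### The procedure for a limit -/

/-- A state of the procedure that computes the limit of the family `E`: `p` holds the answers of
variables at numbers, `a` the answers of variables outside `S`, and `L` arguments at which they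
were given; `todo` lists the variables outside `S` for which it is not yet checked that their
answers agree with `a`. -/
structure LimState (S : Set (Fin n)) (I : Type) : Type where
  E : I → NormalForm S
  p : Fin n → ℕ → Option ℕ
  a : Fin n → Option ℕ
  L : Fin n → Proc n
  todo : List (Fin n × ℕ)

/-- All variables with known answers. -/
def knownAnswers (a : Fin n → Option ℕ) : List (Fin n × ℕ) :=
  (List.finRange n).filterMap fun i => (a i).map fun v => (i, v)

theorem mem_knownAnswers {a : Fin n → Option ℕ} {i : Fin n} {v : ℕ} :
    (i, v) ∈ knownAnswers a ↔ a i = some v := by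
  simp only [knownAnswers, List.mem_filterMap, List.mem_finRange, true_and, Option.map_eq_some_iff,
    Prod.mk.injEq]
  constructor
  · rintro ⟨j, w, h, rfl, rfl⟩
    exact h
  · exact fun h => ⟨i, v, h, rfl, rfl⟩

namespace LimState

variable {S : Set (Fin n)}

/-- An argument at which `x_i` deviates from its known answer if that is the first deviation. -/
noncomputable def testArg (lim : Fin n → (I → FinProc n) → Proc n) (s : LimState S I)
    (i : Fin n) : Proc n :=
  (lim i fun k => (s.E k).deviation s.p s.a i).bind fun t =>
    -- The result `0` means that `x_i` is not the first to deviate; then the recorded argument is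
    -- reused, so that the test returns the known answer.
    Nat.casesOn t (s.L i) fun m => Proc.const (Part.some m)

/-- The family after all queries with known answers. -/
def rest (s : LimState S I) (k : I) : NormalForm S := (s.E k).follow s.p s.a

/-- The state after the answer `v` to a query to `x_j` at `m`. -/
noncomputable def afterAsk (s : LimState S I) (j : Fin n) (m v : ℕ) : LimState S I where
  E k := (s.rest k).next v
  p := Function.update s.p j (Function.update (s.p j) m (some v))
  a := s.a
  L := s.L
  todo := knownAnswers s.a

/-- The state after the answer `v` to a query to `x_j` at `Q`. -/
noncomputable def afterCall (s : LimState S I) (j : Fin n) (Q : Proc n) (v : ℕ) :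
    LimState S I where
  E k := (s.rest k).next v
  p := s.p
  a := Function.update s.a j (some v)
  L := Function.update s.L j Q
  todo := knownAnswers (Function.update s.a j (some v))

/-- The steps of the procedure for the limit of `P`, where `lim i` gives procedures for limits
when `x_i` is strict. -/
noncomputable def step (𝒰 : Ultrafilter I) (lim : Fin n → (I → FinProc n) → Proc n)
    (P : I → FinProc n) : LimState S I ⊕ Proc n → Step n (LimState S I ⊕ Proc n)
  | Sum.inr Q => .done Q
  | Sum.inl s =>
    match s.todo with
    | (i, v) :: l => .query i (s.testArg lim i) fun b =>
        -- Two different answers show that `x_i` is not constant, hence strict, so `lim i` can take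
        -- over for the whole family.
        if b = v then Sum.inl { s with todo := l } else Sum.inr (lim i P)
    | [] =>
      if h : ∃ v, ∀ᶠ k in 𝒰, s.rest k = .ret (some v) then .done (Proc.const (Part.some h.choose))
      else if h : ∃ q : Fin n × ℕ, ∀ᶠ k in 𝒰, (s.rest k).IsAsk q.1 q.2 then
        .query h.choose.1 (Proc.const (Part.some h.choose.2)) fun v =>
          Sum.inl (s.afterAsk h.choose.1 h.choose.2 v)
      else if h : ∃ j, ∀ᶠ k in 𝒰, (s.rest k).IsCall j then
        .query h.choose (lim h.choose fun k => (s.rest k).arg) fun v =>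
          Sum.inl (s.afterCall h.choose (lim h.choose fun k => (s.rest k).arg) v)
      else .done (Proc.const ⊥)

/-- The state `s` is correct for the argument `f` and the values `T`. -/
structure Valid (𝒰 : Ultrafilter I) (lim : Fin n → (I → FinProc n) → Proc n)
    (f : Fin n → Fn) (T : ℕ → Prop) (s : LimState S I) : Prop where
  val : ∀ b, NormalForm.LimN 𝒰 s.E (strictOn S f) b ↔ T b
  num : ∃ D : Finset ℕ, ∀ j m v, s.p j m = some v → m ∈ D ∧ v ∈ strictOn S f j (Part.some m)
  touched : ∀ i v, s.a i = some v → i ∉ S ∧ v ∈ f i (denote (s.L i) f)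
  tested : ∀ i v, s.a i = some v → (i, v) ∉ s.todo → v ∈ f i (denote (s.testArg lim i) f)
  todo : ∀ i v, (i, v) ∈ s.todo → s.a i = some v

/-! ### Correctness of the states -/

section

variable {lim : Fin n → (I → FinProc n) → Proc n}
  (hlim : ∀ i ∉ S, ∀ P f b, Eval f (lim i P) b ↔ LimP 𝒰 P (strictOn (insert i S) f) b)
  {f : Fin n → Fn} {T : ℕ → Prop} {s : LimState S I}

include hlim in
-- The tests must not block a computation that has a value. A strict `x_i` is asked either at its
-- recorded argument or at a number where it deviates, and it answers at both.
theorem Valid.exists_test (hs : s.Valid 𝒰 lim f T) {i : Fin n} {v : ℕ} (hi : s.a i = some v)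
    {b : ℕ} (hb : T b) : ∃ c, c ∈ f i (denote (s.testArg lim i) f) := by
  obtain ⟨hiS, hv⟩ := hs.touched i v hi
  by_cases hd : (f i ⊥).Dom
  · exact ⟨v, Fn.mem_of_mem_bot (Fn.mem_bot_of_mem hd hv) _⟩
  · have hd' : ¬ (strictOn S f i ⊥).Dom := by rwa [strictOn_of_notMem hiS]
    obtain ⟨t, ht⟩ := exists_limP_deviation (a := s.a) hd' hs.num ((hs.val b).mpr hb)
    have ht' := ht
    rw [← strictOn_insert hd, ← hlim i hiS] at ht'
    cases t with
    | zero =>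
      refine ⟨v, mem_of_le_fn (f i) (fun m hm => ?_) hv⟩
      exact mem_denote.mpr (eval_bind_iff.mpr ⟨0, ht', mem_denote.mp hm⟩)
    | succ m =>
      obtain ⟨-, c, -, hc, -⟩ := limP_deviation_succ ht
      rw [strictOn_of_notMem hiS] at hc
      refine ⟨c, mem_of_le_fn (f i) (fun m' hm' => ?_) hc⟩
      rw [Part.mem_some_iff.mp hm']
      exact mem_denote.mpr (eval_bind_iff.mpr ⟨m + 1, ht', eval_const_iff.mpr (Part.mem_some m)⟩)

include hlim in
-- A passed test means that `x_i` is constant or that its search returned `0`: a result `m + 1`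
-- would make the test return the deviating answer at `m`.
theorem Valid.limN_rest (hs : s.Valid 𝒰 lim f T) (htodo : s.todo = []) (b : ℕ) :
    NormalForm.LimN 𝒰 s.rest (strictOn S f) b ↔ T b := by
  rw [← hs.val b]
  refine limN_follow_iff hs.num fun i v hi => ?_
  have hiS := (hs.touched i v hi).1
  have hv := hs.tested i v hi (by simp [htodo])
  rw [strictOn_of_notMem hiS]
  by_cases hd : (f i ⊥).Dom
  · exact Or.inl (Fn.mem_bot_of_mem hd hv)
  · refine Or.inr ⟨hd, ?_⟩
    obtain ⟨r, hr⟩ := Fn.exists_mem_arg hd hv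
    rw [eq_some_of_mem hr] at hv
    obtain ⟨t, ht, hr⟩ := eval_bind_iff.mp (mem_denote.mp hr)
    rw [hlim i hiS, strictOn_insert hd] at ht
    cases t with
    | zero => exact ht
    | succ m =>
      obtain ⟨w, c, hw, hc, hne⟩ := limP_deviation_succ ht
      have hrm : r = m := Part.mem_some_iff.mp (eval_const_iff.mp hr)
      rw [hi] at hw
      rw [strictOn_of_notMem hiS] at hc
      subst hrm
      exact absurd (Part.mem_unique hc hv) (Option.some.inj hw ▸ hne)

theorem Valid.skip (hs : s.Valid 𝒰 lim f T) {i : Fin n} {v : ℕ} {l : List (Fin n × ℕ)}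
    (htodo : s.todo = (i, v) :: l) (hv : v ∈ f i (denote (s.testArg lim i) f)) :
    ({ s with todo := l } : LimState S I).Valid 𝒰 lim f T where
  val := hs.val
  num := hs.num
  touched := hs.touched
  tested j w hj hl := by
    by_cases hji : (j, w) = (i, v)
    · obtain ⟨rfl, rfl⟩ := Prod.mk.inj hji
      exact hv
    · exact hs.tested j w hj (by rw [htodo]; simp only [List.mem_cons]; tauto)
  todo j w h := hs.todo j w (by rw [htodo]; exact List.mem_cons_of_mem _ h)

include hlim in
theorem Valid.afterAsk (hs : s.Valid 𝒰 lim f T) (htodo : s.todo = []) {j : Fin n} {m v : ℕ}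
    (h : ∀ᶠ k in 𝒰, (s.rest k).IsAsk j m) (hv : v ∈ f j (Part.some m)) :
    (s.afterAsk j m v).Valid 𝒰 lim f T where
  val b := by
    rw [← hs.limN_rest hlim htodo b]
    exact limN_ask_iff h (by rwa [strictOn_some])
  num := by
    obtain ⟨D, hD⟩ := hs.num
    refine ⟨insert m D, fun j' m' w hw => ?_⟩
    simp only [LimState.afterAsk, Function.update_apply] at hw
    split_ifs at hw with h1
    · subst h1
      rw [Function.update_apply] at hw
      split_ifs at hw with h2
      · subst h2
        rw [strictOn_some]
        exact ⟨Finset.mem_insert_self _ _, Option.some.inj hw ▸ hv⟩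
      · exact (hD _ _ _ hw).imp_left Finset.mem_insert_of_mem
    · exact (hD _ _ _ hw).imp_left Finset.mem_insert_of_mem
  touched := hs.touched
  tested i w hi hl := absurd (mem_knownAnswers.mpr hi) hl
  todo i w h := mem_knownAnswers.mp h

include hlim in
theorem Valid.afterCall (hs : s.Valid 𝒰 lim f T) (htodo : s.todo = []) {j : Fin n} {v : ℕ}
    (h : ∀ᶠ k in 𝒰, (s.rest k).IsCall j)
    (hv : v ∈ f j (denote (lim j fun k => (s.rest k).arg) f)) :
    (s.afterCall j (lim j fun k => (s.rest k).arg) v).Valid 𝒰 lim f T := by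
  have hjS : j ∉ S := by
    obtain ⟨k, hj, -⟩ := h.exists
    exact hj
  refine ⟨fun b => ?_, hs.num, fun i w hi => ?_,
    fun i w hi hl => absurd (mem_knownAnswers.mpr hi) hl, fun i w h => mem_knownAnswers.mp h⟩
  · rw [← hs.limN_rest hlim htodo b]
    refine limN_call_iff h ?_
    rw [strictOn_of_notMem hjS]
    -- The limit of the arguments was computed for strict `x_j`; this matters only when `x_j` is
    -- strict.
    by_cases hd : (f j ⊥).Dom
    · exact Or.inl (Fn.mem_bot_of_mem hd hv)
    · obtain ⟨r, hr⟩ := Fn.exists_mem_arg hd hv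
      rw [eq_some_of_mem hr] at hv
      rw [mem_denote, hlim j hjS, strictOn_insert hd] at hr
      exact Or.inr ⟨r, hr, hv⟩
  · simp only [LimState.afterCall, Function.update_apply] at hi ⊢
    split_ifs at hi ⊢ with h1
    · subst h1
      exact ⟨hjS, Option.some.inj hi ▸ hv⟩
    · exact hs.touched i w hi

/-! ### Termination and correctness of the steps -/

/-- A measure for the number of queries that are still to be made. -/
noncomputable def rank (D : Finset ℕ) : LimState S I ⊕ Proc n → ℕ ×ₗ ℕ ×ₗ ℕ
  | Sum.inr _ => toLex (0, toLex (0, 0))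
  | Sum.inl s => toLex (((Finset.univ ×ˢ D).filter fun q : Fin n × ℕ => s.p q.1 q.2 = none).card,
      toLex ((Finset.univ.filter fun i => s.a i = none).card, s.todo.length + 1))

theorem rank_skip (D : Finset ℕ) {i : Fin n} {v : ℕ} {l : List (Fin n × ℕ)}
    (htodo : s.todo = (i, v) :: l) :
    rank D (Sum.inl { s with todo := l }) < rank D (Sum.inl s) := by
  simp [rank, Prod.Lex.toLex_lt_toLex, htodo]

theorem rank_inr (D : Finset ℕ) (Q : Proc n) : rank D (Sum.inr Q : LimState S I ⊕ Proc n) < rank D (Sum.inl s) := by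
  simp only [rank, Prod.Lex.toLex_lt_toLex]
  omega

theorem rank_afterAsk {D : Finset ℕ} {j : Fin n} {m : ℕ} (v : ℕ) (hm : m ∈ D)
    (h : s.p j m = none) : rank D (Sum.inl (s.afterAsk j m v)) < rank D (Sum.inl s) := by
  refine Prod.Lex.toLex_lt_toLex.mpr (Or.inl (Finset.card_lt_card ?_))
  refine Finset.ssubset_iff_subset_ne.mpr ⟨fun q hq => ?_, fun he => ?_⟩
  · simp only [Finset.mem_filter, afterAsk, Function.update_apply] at hq ⊢
    refine ⟨hq.1, ?_⟩
    have h2 := hq.2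
    split_ifs at h2 with h3
    rw [Function.update_apply] at h2
    split_ifs at h2
    · rw [h3]; exact h2
    · exact h2
  · have : (j, m) ∈ (Finset.univ ×ˢ D).filter fun q : Fin n × ℕ => s.p q.1 q.2 = none := by
      simp [hm, h]
    rw [← he, Finset.mem_filter] at this
    simp [afterAsk] at this

theorem rank_afterCall (D : Finset ℕ) {j : Fin n} (Q : Proc n) (v : ℕ) (h : s.a j = none) :
    rank D (Sum.inl (s.afterCall j Q v)) < rank D (Sum.inl s) := by
  have hlt : (Finset.univ.filter fun i => (s.afterCall j Q v).a i = none).card <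
      (Finset.univ.filter fun i => s.a i = none).card := by
    refine Finset.card_lt_card (Finset.ssubset_iff_subset_ne.mpr ⟨fun i hi => ?_, fun he => ?_⟩)
    · simp only [Finset.mem_filter, afterCall, Function.update_apply] at hi ⊢
      refine ⟨hi.1, ?_⟩
      have h2 := hi.2
      split_ifs at h2
      exact h2
    · have : j ∈ Finset.univ.filter fun i => s.a i = none := by simp [h]
      rw [← he, Finset.mem_filter] at this
      simp [afterCall] at this
  exact Prod.Lex.toLex_lt_toLex.mpr (Or.inr ⟨rfl, Prod.Lex.toLex_lt_toLex.mpr (Or.inl hlt)⟩)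

/-- Validity of states and of procedures that compute the values `T`. -/
def ValidOr (𝒰 : Ultrafilter I) (lim : Fin n → (I → FinProc n) → Proc n) (f : Fin n → Fn)
    (T : ℕ → Prop) : LimState S I ⊕ Proc n → Prop
  | Sum.inl s => s.Valid 𝒰 lim f T
  | Sum.inr Q => ∀ b, Eval f Q b ↔ T b

variable {P : I → FinProc n}

include hlim in
theorem step_done {x : LimState S I ⊕ Proc n} (hx : ValidOr 𝒰 lim f T x) {Q : Proc n}
    (h : step 𝒰 lim P x = .done Q) (b : ℕ) : Eval f Q b ↔ T b := by
  rcases x with s | R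
  · have hx : s.Valid 𝒰 lim f T := hx
    simp only [step] at h
    split at h
    · cases h
    · rename_i htodo
      rw [← hx.limN_rest hlim htodo b]
      split_ifs at h with h1 h2 h3
      · rw [← Step.done.inj h, eval_const_iff, limN_ret_iff h1.choose_spec, Part.mem_some_iff,
          eq_comm]
      · rw [← Step.done.inj h, eval_const_iff]
        refine ⟨fun hb => absurd hb not_mem_bot, fun hb => ?_⟩
        rcases exists_head (fun i hi => strictOn_strict hi) hb with h | h | h
        exacts [absurd h h1, absurd h h2, absurd h h3]
  · rw [← Step.done.inj h]
    exact hx b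

include hlim in
-- The conjuncts serve soundness, progress and termination, respectively.
theorem step_query (hT : ∀ b, T b ↔ LimP 𝒰 P (strictOn S f) b)
    {x : LimState S I ⊕ Proc n} (hx : ValidOr 𝒰 lim f T x) {i : Fin n} {Q : Proc n}
    {r : ℕ → LimState S I ⊕ Proc n} (h : step 𝒰 lim P x = .query i Q r) :
    (∀ c ∈ f i (denote Q f), ValidOr 𝒰 lim f T (r c)) ∧
    (∀ b, T b → ∃ c, c ∈ f i (denote Q f)) ∧
    ∀ D, SupportedBy (strictOn S f) D → ∀ c ∈ f i (denote Q f), rank D (r c) < rank D x := by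
  rcases x with s | R
  swap
  · cases h
  have hx : s.Valid 𝒰 lim f T := hx
  simp only [step] at h
  split at h
  · rename_i i v l htodo
    cases h
    have hiv := hx.todo i v (by simp [htodo])
    obtain ⟨hiS, hv⟩ := hx.touched i v hiv
    refine ⟨fun c hc => ?_, fun b hb => hx.exists_test hlim hiv hb, fun D _ c hc => ?_⟩
    · dsimp only
      split_ifs with hcv
      · exact hx.skip htodo (hcv ▸ hc)
      · have hd : ¬ (f i ⊥).Dom := fun hd => hcv <|
          Part.mem_unique (Fn.mem_bot_of_mem hd hc) (Fn.mem_bot_of_mem hd hv)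
        intro b
        rw [hlim i hiS, strictOn_insert hd, hT]
    · dsimp only
      split_ifs with hcv
      · exact rank_skip D htodo
      · exact rank_inr D _
  · rename_i htodo
    split_ifs at h with h1 h2 h3
    · have h4 := h2.choose_spec
      generalize h2.choose = q at h h4
      cases h
      simp only [denote_const]
      obtain ⟨k, hj, t, hk⟩ := h4.exists
      refine ⟨fun c hc => hx.afterAsk hlim htodo h4 hc, fun b hb => ?_, fun D hD c hc => ?_⟩
      · rw [← hx.limN_rest hlim htodo b] at hb
        simpa only [strictOn_some] using exists_mem_of_limN_ask h4 hb
      · refine rank_afterAsk c (hD q.1 q.2 (strictOn_strict hj) ?_) (NormalForm.follow_eq_ask hk)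
        rw [strictOn_some]
        exact hc.1
    · have h4 := h3.choose_spec
      generalize h3.choose = j at h h4
      cases h
      obtain ⟨k, hj, R, t, hk⟩ := h4.exists
      refine ⟨fun c hc => hx.afterCall hlim htodo h4 hc, fun b hb => ?_,
        fun D _ c _ => rank_afterCall D _ c (NormalForm.follow_eq_call hk)⟩
      by_cases hd : (f i ⊥).Dom
      · exact ⟨_, Fn.mem_of_mem_bot (Part.get_mem hd) _⟩
      · rw [← hx.limN_rest hlim htodo b] at hb
        obtain ⟨r, hr, v, hv⟩ := exists_mem_of_limN_call
          (by rwa [strictOn_of_notMem hj]) h4 hb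
        rw [strictOn_of_notMem hj] at hv
        rw [← strictOn_insert hd, ← hlim _ hj, ← mem_denote] at hr
        exact ⟨v, by rwa [eq_some_of_mem hr]⟩

/-- The initial state. -/
noncomputable def init (S : Set (Fin n)) (P : I → FinProc n) : LimState S I where
  E k := (P k).normalize S
  p := fun _ _ => none
  a := fun _ => none
  L := fun _ => Proc.const ⊥
  todo := []

theorem valid_init (f : Fin n → Fn) (P : I → FinProc n) :
    (init S P).Valid 𝒰 lim f (LimP 𝒰 P (strictOn S f)) where
  val _ := limP_normalize_iff fun _ hi => strictOn_strict hi
  num := ⟨∅, fun _ _ _ h => nomatch h⟩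
  touched _ _ h := nomatch h
  tested _ _ h := nomatch h
  todo _ _ h := absurd h List.not_mem_nil

include hlim in
theorem eval_run_iff (P : I → FinProc n) (f : Fin n → Fn) (b : ℕ) :
    Eval f (run (step 𝒰 lim P) (Sum.inl (init S P))) b ↔ LimP 𝒰 P (strictOn S f) b := by
  constructor
  · intro h
    refine run_sound (fun x b => ValidOr 𝒰 lim f (LimP 𝒰 P (strictOn S f)) x →
      LimP 𝒰 P (strictOn S f) b) ?_ ?_ h (valid_init f P)
    · intro x Q b hs hb hx
      exact (step_done hlim hx hs b).mp hb
    · intro x i Q r hs c hc b ih hx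
      exact ih ((step_query hlim (fun _ => Iff.rfl) hx hs).1 c hc)
  · intro h
    obtain ⟨D, hD⟩ := h.exists_restrict
    -- Termination is proved at a finite part `g` that already gives the value; the run at `f` then
    -- follows by monotonicity.
    set g := restrictAll (strictOn S f) D with hg
    have hgS : strictOn S g = g :=
      strictOn_eq_self fun i hi => restrictAll_strict (strictOn_strict hi) D
    have hgD : SupportedBy (strictOn S g) D := by
      rw [hgS]
      exact supportedBy_restrictAll _ _
    rw [← hgS] at hD
    have key : ∀ x : LimState S I ⊕ Proc n, ValidOr 𝒰 lim g (LimP 𝒰 P (strictOn S g)) x →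
        Eval g (run (step 𝒰 lim P) x) b := by
      intro x
      induction x using (InvImage.wf (rank D) wellFounded_lt).induction with
      | _ x ih =>
      intro hx
      cases hs : step 𝒰 lim P x with
      | done Q =>
        rw [run_of_done hs]
        exact (step_done hlim hx hs b).mpr hD
      | query i Q r =>
        obtain ⟨h1, h2, h3⟩ := step_query hlim (fun _ => Iff.rfl) hx hs
        obtain ⟨c, hc⟩ := h2 b hD
        rw [run_of_query hs]
        exact eval_caseOf_iff.mpr ⟨c, hc, ih _ (h3 D hgD c hc) (h1 c hc)⟩
    have hle : g ≤ f := (restrictAll_le _ _).trans (strictOn_le S f)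
    exact mem_denote.mp (denote_mono _ hle b (mem_denote.mpr (key _ (valid_init g P))))

end

end LimState

/-- Limits of well-founded procedures along an ultrafilter are sequential, also if some of the
arguments are replaced by their strict parts. -/
theorem exists_proc_lim (𝒰 : Ultrafilter I) (S : Set (Fin n)) (P : I → FinProc n) :
    ∃ Q : Proc n, ∀ f b, Eval f Q b ↔ LimP 𝒰 P (strictOn S f) b := by
  induction hm : (Sᶜ).ncard using Nat.strong_induction_on generalizing S P with
  | _ m ih =>
  have h : ∀ i, ∀ P : I → FinProc n, ∃ Q : Proc n, i ∉ S → ∀ f b,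
      Eval f Q b ↔ LimP 𝒰 P (strictOn (insert i S) f) b := by
    intro i P
    by_cases hi : i ∈ S
    -- A dummy: `lim i` is specified for `i ∉ S` only.
    · exact ⟨Proc.const ⊥, fun h => absurd hi h⟩
    · obtain ⟨Q, hQ⟩ := ih _ (by
        rw [← hm]
        refine Set.ncard_lt_ncard ?_ (Set.toFinite _)
        exact compl_lt_compl_iff_lt.mpr (Set.ssubset_insert hi)) (insert i S) P rfl
      exact ⟨Q, fun _ => hQ⟩
  choose lim hlim using h
  exact ⟨_, LimState.eval_run_iff (lim := lim) (fun i hi P => hlim i P hi) P⟩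

/-! ### Least upper bounds of directed sets -/

/-- The common source of all three claims: `S = ∅` gives the plain suprema, and general `S` the Key
Lemma. -/
theorem exists_isSequential_sup {D : Set (Functional n)} (hne : D.Nonempty)
    (hdir : DirectedOn (· ≤ ·) D) (hD : ∀ F ∈ D, IsSequential F) (S : Set (Fin n)) :
    ∃ G : Functional n, IsSequential G ∧
      ∀ f b, b ∈ G f ↔ ∃ F ∈ D, b ∈ F (strictOn S f) := by
  have := hne.to_subtype
  have : IsDirectedOrder D := directedOn_iff_isDirectedOrder.mp hdir
  choose P hP using fun F : D => hD F F.2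
  have : ((atTop : Filter D).curry (atTop : Filter ℕ)).NeBot := by
    refine ⟨fun h => ?_⟩
    have h1 : ∀ᶠ k in (atTop : Filter D).curry (atTop : Filter ℕ), False := by
      rw [h]
      exact eventually_bot
    obtain ⟨F, hF⟩ := (eventually_curry_iff.mp h1).exists
    exact hF.exists.elim fun _ h => h
  -- In the curried filter the depth is chosen after the functional, so a sufficient depth may
  -- depend on the functional.
  set 𝒰 : Ultrafilter (D × ℕ) := Ultrafilter.of ((atTop : Filter D).curry (atTop : Filter ℕ))
  obtain ⟨Q, hQ⟩ := exists_proc_lim 𝒰 S fun k => (P k.1).trunc k.2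
  refine ⟨denote Q, ⟨Q, rfl⟩, fun f b => ?_⟩
  rw [mem_denote, hQ]
  constructor
  · rintro ⟨D', h⟩
    obtain ⟨⟨F, d⟩, h⟩ := h.exists
    refine ⟨F, F.2, (hD F F.2).monotone (restrictAll_le _ D') b ?_⟩
    rw [← hP F, mem_denote]
    exact Proc.eval_of_mem_trunc h
  · rintro ⟨F, hF, hb⟩
    lift F to D using hF
    rw [← hP F, mem_denote] at hb
    obtain ⟨d, hd⟩ := Proc.exists_mem_trunc hb
    -- The restriction is fixed by the single functional `F`; all larger ones have the value `b`
    -- there too, as `Lim` requires.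
    obtain ⟨D', hD'⟩ := FinProc.exists_restrict (hd d le_rfl)
    have hF' : b ∈ F.1 (restrictAll (strictOn S f) D') := by
      rw [← hP F, mem_denote]
      exact Proc.eval_of_mem_trunc hD'
    refine ⟨D', Ultrafilter.of_le _ ?_⟩
    refine eventually_curry_iff.mpr ?_
    filter_upwards [eventually_ge_atTop F] with F' hle
    have h1 : Eval (restrictAll (strictOn S f) D') (P F') b := by
      rw [← mem_denote, hP F']
      exact hle _ b hF'
    obtain ⟨d', hd'⟩ := Proc.exists_mem_trunc h1
    exact (eventually_ge_atTop d').mono hd'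

theorem isLUB_of_mem_iff {D : Set (Functional n)} {G : Functional n}
    (h : ∀ f b, b ∈ G f ↔ ∃ F ∈ D, b ∈ F f) : IsLUB D G :=
  ⟨fun F hF f b hb => (h f b).mpr ⟨F, hF, hb⟩, fun H hH f b hb => by
    obtain ⟨F, hF, hb⟩ := (h f b).mp hb
    exact hH hF f b hb⟩

theorem strictOn_empty (f : Fin n → Fn) : strictOn ∅ f = f :=
  strictOn_eq_self fun _ h => absurd h (Set.notMem_empty _)

/-- `strictOn S f` is the largest tuple below `f` that is strict in `S`, so by monotonicity it is
the only one to consider. -/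
theorem mem_strictify_iff {S : Set (Fin n)} {F : Functional n} (hF : Monotone F)
    {f : Fin n → Fn} {a : ℕ} : a ∈ strictify S F f ↔ a ∈ F (strictOn S f) := by
  rw [mem_strictify hF]
  constructor
  · rintro ⟨g, hgf, hg, ha⟩
    have h : strictOn S g = g := strictOn_eq_self fun i hi => by
      rw [hg i hi]
      exact not_dom_bot
    exact hF (h ▸ strictOn_mono hgf) a ha
  · exact fun ha => ⟨_, strictOn_le S f,
      fun i hi => Part.eq_none_iff'.mpr (strictOn_strict hi), ha⟩

end SeqFun

/-- Least upper bounds in `SeqFun.Functional n` are taken in the pointwise order on all functions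
`(ℕ_⊥ → ℕ_⊥)^n → ℕ_⊥`, so they are pointwise least upper bounds. -/
theorem theorem3p1 (n : ℕ) :
    (∀ F : ℕ → SeqFun.Functional n, Monotone F → (∀ k, SeqFun.IsSequential (F k)) →
      ∃ G : SeqFun.Functional n, IsLUB (Set.range F) G ∧ SeqFun.IsSequential G) ∧
    (∀ D : Set (SeqFun.SeqFunctional n), D.Nonempty → DirectedOn (· ≤ ·) D →
      ∃ G : SeqFun.SeqFunctional n, IsLUB D G ∧ IsLUB (Subtype.val '' D) G.1) ∧
    (∀ (S : Set (Fin n)) (F : ℕ → SeqFun.Functional n), Monotone F →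
      (∀ k, SeqFun.IsSequential (F k)) →
      ∃ G : SeqFun.Functional n,
        IsLUB (Set.range fun k => SeqFun.strictify S (F k)) G ∧ SeqFun.IsSequential G) := by
  refine ⟨fun F hF hs => ?_, fun D hne hD => ?_, fun S F hF hs => ?_⟩
  · obtain ⟨G, hG, h⟩ := SeqFun.exists_isSequential_sup (Set.range_nonempty F)
      (directedOn_range.mpr hF.directed_le) (Set.forall_mem_range.mpr hs) ∅
    simp only [SeqFun.strictOn_empty] at h
    exact ⟨G, SeqFun.isLUB_of_mem_iff h, hG⟩
  · obtain ⟨G, hG, h⟩ := SeqFun.exists_isSequential_sup (hne.image Subtype.val)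
      (directedOn_image.mpr hD) (by rintro _ ⟨F, -, rfl⟩; exact F.2) ∅
    simp only [SeqFun.strictOn_empty] at h
    have hlub := SeqFun.isLUB_of_mem_iff h
    exact ⟨⟨G, hG⟩, ⟨fun F hF => hlub.1 ⟨F, hF, rfl⟩,
      fun H hH => hlub.2 (by rintro _ ⟨F, hF, rfl⟩; exact hH hF)⟩, hlub⟩
  · obtain ⟨G, hG, h⟩ := SeqFun.exists_isSequential_sup (Set.range_nonempty F)
      (directedOn_range.mpr hF.directed_le) (Set.forall_mem_range.mpr hs) S
    refine ⟨G, SeqFun.isLUB_of_mem_iff fun f b => ?_, hG⟩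
    rw [h]
    simp only [Set.exists_range_iff]
    exact exists_congr fun k => (SeqFun.mem_strictify_iff (hs k).monotone).symm
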